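/- Let $n\ge 1$, $1\le m<N$, write $X=(x,y)\in\mathbb R^m\times\mathbb R^{N-m}=\mathbb R^N$, and let $\Omega\subset\mathbb R^N$ be open. For $i=1,\dots,n$ let $a_i=a_i(x,t)$ be such that $a_i\in L^\infty(\mathbb R^m\times[\alpha_-,\alpha_+])$ for all $\alpha_+>\alpha_->0$, $\inf_{x}a_i(x,t)>0$ for each $t>0$, and $t\mapsto a_i(x,t)$ is $C^1$ on $(0,\infty)$ for each $x$. Let $F=F(x,\xi^1,\dots,\xi^n)$ be such that $F(x,\cdot)\in C^2(\mathbb R^n)$ for each $x\in\mathbb R^m$; put $F_i=\partial_{\xi^i}F$, $F_{ij}=\partial_{\xi^i}\partial_{\xi^j}F$, and write $F_i$, $F_{ij}$ also for $F_i(x,u^1(X),\dots,u^n(X))$, $F_{ij}(x,u^1(X),\dots,u^n(X))$. Put $$\mathcal A^k_{ij}(x,\eta)=a_k(x,|\eta|)\delta_{ij}+\partial_t a_k(x,|\eta|)\frac{\eta_i\eta_j}{|\eta|}\quad(\eta\ne0),\qquad \mathcal A^k(x,0)=a_k(x,0)\,\mathrm{Id},$$ where $a_k(x,0)$ is an arbitrary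 fixed value, and $\mathcal A^k=\mathcal A^k(x,\nabla u^k(X))$. Let $(u^1,\dots,u^n)$ satisfy, for each $i$: $u^i\in C^1(\Omega)\cap C^2(\Omega\cap\{\nabla u^i\ne0\})\cap L^\infty(\Omega)$; $\nabla u^i\in L^\infty(\Omega,\mathbb R^N)\cap W^{1,2}_{loc}(\Omega,\mathbb R^N)$; and $X\mapsto\mathcal A^i(x,\nabla u^i(X))$ belongs to $L^\infty(\Omega\cap\{\nabla u^i\ne0\}\cap B_R)$ for all $R>0$. Assume that it is a weak solution in $\Omega$ of the system $-\operatorname{div}(a_i(x,|\nabla u^i|)\nabla u^i)=F_i(x,u^1,\dots,u^n)$, $i=1,\dots,n$, i.e. the functions $a_i(x,|\nabla u^i|)\nabla u^i$ and $F_i$ are locally integrable in $\Omega$ and $$\int_\Omega\langle a_i(x,|\nabla u^i|)\nabla u^i,\nabla\psi^i\rangle=\int_\Omega F_i\,\psi^i,\qquad i=1,\dots,n,\quad \psi\in C_c^\infty(\Omega,\mathbb R^n),$$ and that it is stable, i.e. $F_{ij}$ is locally integrable in $\Omega$, the functions $\langle\mathcal A^i\nabla\varphi,\nabla\varphi\rangle$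 with $\varphi\in C_c^\infty(\Omega)$ are integrable in $\Omega$, and $$\sum_{i}\int_\Omega\langle\mathcal A^i\nabla\psi^i,\nabla\psi^i\rangle-\sum_{i,j}\int_\Omega F_{ij}\psi^i\psi^j\ge0,\qquad \psi\in C_c^\infty(\Omega,\mathbb R^n).$$ For a function $u$ put $\mathcal R_u=\{X\in\Omega:\nabla_yu(X)\ne0\}$ and, on $\mathcal R_u$, $$\mathcal S_u=\sum_{i=1}^m\sum_{j=1}^{N-m}(u_{x_iy_j})^2-|\nabla_x|\nabla_yu||^2,\qquad \mathcal T_u=\sum_{j=1}^{N-m}\langle\nabla u,\nabla u_{y_j}\rangle^2-\langle\nabla u,\nabla|\nabla_yu|\rangle^2 .$$ For $X=(x,y)\in\mathcal R_u$ let $L$ be the level set of $u(x,\cdot)$ through $y$ (a hypersurface of $\mathbb R^{N-m}$ near $y$), with unit normal $\nu=\nabla_yu/|\nabla_yu|$; let $\mathcal K_u(X)=(\sum_{j=1}^{N-m-1}k_j^2)^{1/2}$, where $k_1,\dots,k_{N-m-1}$ are the principal curvatures of $L$ at $y$, and let $\nabla_LG=\nabla_yG-\langle\nabla_yG,\nu\rangle\nu$.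 Then, for every $\psi=(\psi^1,\dots,\psi^n)\in C_c^\infty(\Omega,\mathbb R^n)$, all the integrands below are integrable, and $$\sum_{k=1}^n\int_{\mathcal R_{u^k}}\Big(\sum_{j=1}^{N-m}\langle\mathcal A^k\nabla u^k_{y_j},\nabla u^k_{y_j}\rangle-\langle\mathcal A^k\nabla|\nabla_yu^k|,\nabla|\nabla_yu^k|\rangle\Big)(\psi^k)^2$$ $$-\sum_{k\ne j}\int_\Omega F_{kj}\Big((\psi^k)^2\langle\nabla_yu^j,\nabla_yu^k\rangle-\psi^j\psi^k|\nabla_yu^k||\nabla_yu^j|\Big)\le\int_\Omega\sum_{k=1}^n\langle\mathcal A^k\nabla\psi^k,\nabla\psi^k\rangle|\nabla_yu^k|^2 .$$ Moreover, $$\sum_{k=1}^n\int_{\mathcal R_{u^k}}\Big[a_k(x,|\nabla u^k|)\big(\mathcal S_{u^k}+\mathcal K_{u^k}^2|\nabla_yu^k|^2+|\nabla_L|\nabla_yu^k||^2\big)+\frac{\partial_ta_k(x,|\nabla u^k|)}{|\nabla u^k|}\mathcal T_{u^k}\Big](\psi^k)^2$$ $$\le\int_\Omega\sum_{k=1}^n\langle\mathcal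 A^k\nabla\psi^k,\nabla\psi^k\rangle|\nabla_yu^k|^2+\sum_{k\ne j}\int_\Omega F_{kj}\Big((\psi^k)^2\langle\nabla_yu^j,\nabla_yu^k\rangle-\psi^j\psi^k|\nabla_yu^k||\nabla_yu^j|\Big).$$ -/

import Mathlib

open MeasureTheory Set
open scoped ContDiff

noncomputable section

namespace Fibered

/-- The space `ℝ^N = ℝ^m × ℝ^d`, `d = N - m`, with its Euclidean structure; the coordinates
`Sum.inl i` are `x_i` and the coordinates `Sum.inr j` are `y_j`. -/
abbrev E (m d : ℕ) : Type := EuclideanSpace ℝ (Fin m ⊕ Fin d)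

variable {m d n : ℕ}

/-- The component `x` of `X = (x, y)`. -/
def xPart (X : E m d) : EuclideanSpace ℝ (Fin m) := WithLp.toLp 2 fun i => X (Sum.inl i)

/-- The component `y` of `X = (x, y)`. -/
def yPart (X : E m d) : EuclideanSpace ℝ (Fin d) := WithLp.toLp 2 fun j => X (Sum.inr j)

/-- The point `X = (x, y)`. -/
def join (x : EuclideanSpace ℝ (Fin m)) (y : EuclideanSpace ℝ (Fin d)) : E m d :=
  WithLp.toLp 2 (Sum.elim (fun i => x i) (fun j => y j))

/-- The partial derivative of `f` with respect to the coordinate `b`. -/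
def pd {ι : Type} [Fintype ι] [DecidableEq ι] (f : EuclideanSpace ℝ ι → ℝ) (b : ι)
    (X : EuclideanSpace ℝ ι) : ℝ :=
  fderiv ℝ f X (EuclideanSpace.single b 1)

/-- The partial gradient `∇_x f`. -/
def gradX (f : E m d → ℝ) (X : E m d) : EuclideanSpace ℝ (Fin m) :=
  WithLp.toLp 2 fun i => pd f (Sum.inl i) X

/-- The partial gradient `∇_y f`. -/
def gradY (f : E m d → ℝ) (X : E m d) : EuclideanSpace ℝ (Fin d) :=
  WithLp.toLp 2 fun j => pd f (Sum.inr j) X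

/-- The function `|∇_y f|`. -/
def normGradY (f : E m d → ℝ) (X : E m d) : ℝ := ‖gradY f X‖

/-! ### Function spaces -/

/-- `φ ∈ C_c^∞(Ω)`. -/
def IsTest (Ω : Set (E m d)) (φ : E m d → ℝ) : Prop :=
  ContDiff ℝ ∞ φ ∧ HasCompactSupport φ ∧ tsupport φ ⊆ Ω

/-- `f ∈ L²_loc(Ω)`. -/
def MemL2loc (Ω : Set (E m d)) (f : E m d → ℝ) : Prop :=
  ∀ K : Set (E m d), IsCompact K → K ⊆ Ω → MemLp f 2 (volume.restrict K)

/-- `g` is the weak partial derivative of `f` in `Ω` with respect to the coordinate `b`. -/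
def IsWeakPartial (Ω : Set (E m d)) (f : E m d → ℝ) (b : Fin m ⊕ Fin d) (g : E m d → ℝ) : Prop :=
  ∀ φ : E m d → ℝ, IsTest Ω φ → ∫ X in Ω, f X * pd φ b X = - ∫ X in Ω, g X * φ X

/-- `f ∈ W^{1,2}_loc(Ω)`. -/
def MemW12loc (Ω : Set (E m d)) (f : E m d → ℝ) : Prop :=
  MemL2loc Ω f ∧ ∀ b, ∃ g : E m d → ℝ, MemL2loc Ω g ∧ IsWeakPartial Ω f b g

/-! ### The system -/

/-- The assumptions on a coefficient `a = a(x, t)`. Nothing is assumed on the values `a(x, 0)`. -/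
structure IsCoefficient (a : EuclideanSpace ℝ (Fin m) → ℝ → ℝ) : Prop where
  memLp : ∀ r s : ℝ, 0 < r → r < s →
    MemLp (fun p : EuclideanSpace ℝ (Fin m) × ℝ => a p.1 p.2) ⊤
      (volume.restrict (univ ×ˢ Icc r s))
  inf_pos : ∀ t : ℝ, 0 < t → ∃ c : ℝ, 0 < c ∧ ∀ x, c ≤ a x t
  contDiffOn : ∀ x, ContDiffOn ℝ 1 (a x) (Ioi 0)

/-- The matrix `𝒜_{ij}(x, η) = a(x, |η|) δ_{ij} + ∂_t a(x, |η|) η_i η_j / |η|`, for `η ≠ 0`.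
For `η = 0` it is `a(x, 0)` times the identity. -/
def coeffMatrix (a : EuclideanSpace ℝ (Fin m) → ℝ → ℝ) (x : EuclideanSpace ℝ (Fin m))
    (η : E m d) : Matrix (Fin m ⊕ Fin d) (Fin m ⊕ Fin d) ℝ :=
  Matrix.of fun i j => a x ‖η‖ * (if i = j then 1 else 0) + deriv (a x) ‖η‖ * (η i * η j / ‖η‖)

/-- `⟨𝒜(x, ∇u(X)) v, w⟩` at the point `X = (x, y)`. -/
def formA (a : EuclideanSpace ℝ (Fin m) → ℝ → ℝ) (u : E m d → ℝ) (X : E m d) (v w : E m d) : ℝ :=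
  inner ℝ (Matrix.toEuclideanLin (coeffMatrix a (xPart X) (gradient u X)) v) w

/-- `(u^1(X), …, u^n(X))`. -/
def tuple (u : Fin n → E m d → ℝ) (X : E m d) : EuclideanSpace ℝ (Fin n) :=
  WithLp.toLp 2 fun i => u i X

/-- `F_i(x, u^1(X), …, u^n(X))`, where `F_i = ∂F/∂ξ^i`. -/
def F1 (F : EuclideanSpace ℝ (Fin m) → EuclideanSpace ℝ (Fin n) → ℝ) (u : Fin n → E m d → ℝ)
    (i : Fin n) (X : E m d) : ℝ :=
  pd (F (xPart X)) i (tuple u X)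

/-- `F_{ij}(x, u^1(X), …, u^n(X))`, where `F_{ij} = ∂²F/∂ξ^i∂ξ^j`. -/
def F2 (F : EuclideanSpace ℝ (Fin m) → EuclideanSpace ℝ (Fin n) → ℝ) (u : Fin n → E m d → ℝ)
    (i j : Fin n) (X : E m d) : ℝ :=
  pd (pd (F (xPart X)) i) j (tuple u X)

/-- The regularity assumed of each component of a solution. -/
structure IsRegular (Ω : Set (E m d)) (u : E m d → ℝ) : Prop where
  contDiffOn_one : ContDiffOn ℝ 1 u Ω
  contDiffOn_two : ContDiffOn ℝ 2 u {X | X ∈ Ω ∧ gradient u X ≠ 0}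
  bounded : ∃ C : ℝ, ∀ X ∈ Ω, |u X| ≤ C
  gradient_bounded : ∃ C : ℝ, ∀ X ∈ Ω, ‖gradient u X‖ ≤ C
  gradient_memW12loc : ∀ b, MemW12loc Ω (pd u b)

/-- `X ↦ 𝒜(x, ∇u(X))` belongs to `L^∞({∇u ≠ 0} ∩ B_R)` for every `R > 0`. -/
def BoundedMatrix (Ω : Set (E m d)) (a : EuclideanSpace ℝ (Fin m) → ℝ → ℝ) (u : E m d → ℝ) :
    Prop :=
  ∀ R : ℝ, 0 < R → ∀ i j, MemLp (fun X => coeffMatrix a (xPart X) (gradient u X) i j) ⊤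
    (volume.restrict ({X | X ∈ Ω ∧ gradient u X ≠ 0} ∩ Metric.ball 0 R))

/-- `(u^1, …, u^n)` is a weak solution in `Ω` of
`-div (a_i(x, |∇u^i|) ∇u^i) = F_i(x, u^1, …, u^n)`, `i = 1, …, n`;
the local integrability says that the integrals make sense. -/
structure IsWeakSolution (Ω : Set (E m d)) (a : Fin n → EuclideanSpace ℝ (Fin m) → ℝ → ℝ)
    (F : EuclideanSpace ℝ (Fin m) → EuclideanSpace ℝ (Fin n) → ℝ) (u : Fin n → E m d → ℝ) :
    Prop where
  flux_integrable : ∀ i, LocallyIntegrableOn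
    (fun X => a i (xPart X) ‖gradient (u i) X‖ • gradient (u i) X) Ω
  source_integrable : ∀ i, LocallyIntegrableOn (F1 F u i) Ω
  weak_eq : ∀ ψ : Fin n → E m d → ℝ, (∀ i, IsTest Ω (ψ i)) → ∀ i,
    ∫ X in Ω, inner ℝ (a i (xPart X) ‖gradient (u i) X‖ • gradient (u i) X) (gradient (ψ i) X)
      = ∫ X in Ω, F1 F u i X * ψ i X

/-- Stability of `(u^1, …, u^n)` in `Ω`; the integrability says that the integrals make sense. -/
structure IsStable (Ω : Set (E m d)) (a : Fin n → EuclideanSpace ℝ (Fin m) → ℝ → ℝ)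
    (F : EuclideanSpace ℝ (Fin m) → EuclideanSpace ℝ (Fin n) → ℝ) (u : Fin n → E m d → ℝ) :
    Prop where
  potential_integrable : ∀ i j, LocallyIntegrableOn (F2 F u i j) Ω
  form_integrable : ∀ i, ∀ φ : E m d → ℝ, IsTest Ω φ →
    IntegrableOn (fun X => formA (a i) (u i) X (gradient φ X) (gradient φ X)) Ω
  nonneg : ∀ ψ : Fin n → E m d → ℝ, (∀ i, IsTest Ω (ψ i)) →
    0 ≤ (∑ i, ∫ X in Ω, formA (a i) (u i) X (gradient (ψ i) X) (gradient (ψ i) X))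
      - ∑ i, ∑ j, ∫ X in Ω, F2 F u i j X * ψ i X * ψ j X

/-! ### Geometric quantities -/

/-- `ℛ_u = {X ∈ Ω | ∇_y u(X) ≠ 0}`. -/
def regularSet (Ω : Set (E m d)) (u : E m d → ℝ) : Set (E m d) :=
  {X | X ∈ Ω ∧ gradY u X ≠ 0}

/-- `𝒮_u = ∑_{i,j} (u_{x_i y_j})² - |∇_x |∇_y u||²`. -/
def quantS (u : E m d → ℝ) (X : E m d) : ℝ :=
  (∑ i : Fin m, ∑ j : Fin d, (pd (pd u (Sum.inr j)) (Sum.inl i) X) ^ 2)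
    - ‖gradX (normGradY u) X‖ ^ 2

/-- `𝒯_u = ∑_j ⟨∇u, ∇u_{y_j}⟩² - ⟨∇u, ∇|∇_y u|⟩²`. -/
def quantT (u : E m d → ℝ) (X : E m d) : ℝ :=
  (∑ j : Fin d, (inner ℝ (gradient u X) (gradient (pd u (Sum.inr j)) X)) ^ 2)
    - (inner ℝ (gradient u X) (gradient (normGradY u) X)) ^ 2

/-- The unit normal `∇_y u / |∇_y u|` of the level sets `{y | u(x, y) = c}`, as a function of `y`. -/
def unitNormal (u : E m d → ℝ) (x : EuclideanSpace ℝ (Fin m)) (y : EuclideanSpace ℝ (Fin d)) :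
    EuclideanSpace ℝ (Fin d) :=
  ‖gradY u (join x y)‖⁻¹ • gradY u (join x y)

/-- The gradient of `G` in `y`, tangential to the level set of `u(x, ·)` through `y`. -/
def tangentialGrad (u G : E m d → ℝ) (X : E m d) : EuclideanSpace ℝ (Fin d) :=
  gradY G X - inner ℝ (gradY G X) (unitNormal u (xPart X) (yPart X)) •
    unitNormal u (xPart X) (yPart X)

/-- The tangent space at `y` of the level set of `u(x, ·)` through `y`. -/
def tangentSpace (u : E m d → ℝ) (X : E m d) : Submodule ℝ (EuclideanSpace ℝ (Fin d)) :=
  (Submodule.span ℝ {gradY u X})ᗮ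

/-- The shape operator (Weingarten map) `v ↦ -D_y ν(v)` of the level set of `u(x, ·)` through `y`,
as an endomorphism of the tangent space. -/
def shapeOperator (u : E m d → ℝ) (X : E m d) : tangentSpace u X →ₗ[ℝ] tangentSpace u X :=
  (tangentSpace u X).orthogonalProjectionOnto.toLinearMap ∘ₗ
    (-(fderiv ℝ (unitNormal u (xPart X)) (yPart X)).toLinearMap) ∘ₗ (tangentSpace u X).subtype

/-- The principal curvatures `k_1, …, k_{d-1}` of the level set, that is, the eigenvalues of the
shape operator, with multiplicity. -/
def principalCurvatures (u : E m d → ℝ) (X : E m d) : Multiset ℝ :=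
  (shapeOperator u X).charpoly.roots

/-- The length `𝒦_u` of the second fundamental form of the level set. -/
def quantK (u : E m d → ℝ) (X : E m d) : ℝ :=
  Real.sqrt ((principalCurvatures u X).map fun k => k ^ 2).sum

/-! ### The integrands of the inequality -/

/-- `∑_j ⟨𝒜 ∇u_{y_j}, ∇u_{y_j}⟩ - ⟨𝒜 ∇|∇_y u|, ∇|∇_y u|⟩`. -/
def formTerm (a : EuclideanSpace ℝ (Fin m) → ℝ → ℝ) (u : E m d → ℝ) (X : E m d) : ℝ :=
  (∑ j : Fin d,
      formA a u X (gradient (pd u (Sum.inr j)) X) (gradient (pd u (Sum.inr j)) X))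
    - formA a u X (gradient (normGradY u) X) (gradient (normGradY u) X)

/-- `a(x, |∇u|) (𝒮_u + 𝒦_u² |∇_y u|² + |∇_L |∇_y u||²) + ∂_t a(x, |∇u|) / |∇u| * 𝒯_u`. -/
def geometricTerm (a : EuclideanSpace ℝ (Fin m) → ℝ → ℝ) (u : E m d → ℝ) (X : E m d) : ℝ :=
  a (xPart X) ‖gradient u X‖ *
      (quantS u X + quantK u X ^ 2 * ‖gradY u X‖ ^ 2 + ‖tangentialGrad u (normGradY u) X‖ ^ 2)
    + deriv (a (xPart X)) ‖gradient u X‖ / ‖gradient u X‖ * quantT u X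

/-- `F_{kj} ((ψ^k)² ⟨∇_y u^j, ∇_y u^k⟩ - ψ^j ψ^k |∇_y u^k| |∇_y u^j|)`. -/
def couplingTerm (F : EuclideanSpace ℝ (Fin m) → EuclideanSpace ℝ (Fin n) → ℝ)
    (u ψ : Fin n → E m d → ℝ) (k j : Fin n) (X : E m d) : ℝ :=
  F2 F u k j X * (ψ k X ^ 2 * inner ℝ (gradY (u j) X) (gradY (u k) X)
    - ψ j X * ψ k X * (‖gradY (u k) X‖ * ‖gradY (u j) X‖))

/-- `⟨𝒜 ∇ψ, ∇ψ⟩ |∇_y u|²`. -/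
def energyTerm (a : EuclideanSpace ℝ (Fin m) → ℝ → ℝ) (u ψ : E m d → ℝ) (X : E m d) : ℝ :=
  formA a u X (gradient ψ X) (gradient ψ X) * ‖gradY u X‖ ^ 2

end Fibered

end

noncomputable section

namespace Fibered

open Filter Topology

variable {m d n : ℕ}

/-! ### Partial derivatives and the gradient -/

/-! Write w_k = |∇_y u^k|. The coefficients a_k and the potential F see X only through x and the
unknowns, so the system can be differentiated in y_j: away from the critical points of u^k, the
function u^k_{y_j} solves -div(𝒜^k ∇u^k_{y_j}) = ∑_i F_{ki} u^i_{y_j} (`IsWeakSolution.linearized`).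
This equation is tested with (ψ^k)² u^k_{y_j} and summed over j (`IsWeakSolution.linearized_gradY`),
while stability is tested with ψ^k w_k (`IsStable.nonneg_normGradY`). Because ∑_j u_{y_j} ∇u_{y_j} =
w ∇w, both computations contain the same mixed term 2 ∫ ψ w ⟨𝒜∇ψ, ∇w⟩. Eliminating it gives the
first inequality (`sum_integral_formTerm_le`); the potential terms with j = k cancel since |∇_y
u^k|² = w_k².

Neither test function is smooth, and near critical points u need not be C² and 𝒜 is not controlled.
Both functions are therefore multiplied by a cutoff χ_l(w_k) that vanishes for w_k ≤ 1/(l+1). The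
products are C¹ with compact support in {∇_y u^k ≠ 0} (`IsRegular.cutoff_mul`), and mollification
extends the equation and the stability inequality to such functions. The limit l → ∞ is dominated
convergence. It rests on the uniform bound |t χ_l'(t)| ≤ C (`exists_abs_mul_deriv_cutoff_le`) and on
the local square integrability of the second derivatives and of ∇w up to the boundary of the regular
set in Ω (`IsRegular.memLp_pd_pd`, `IsRegular.memLp_gradient_normGradY`). All second-order integrals
stay on the regular set, so nothing has to be known about second derivatives on its complement.

The second inequality is the first with its integrand rewritten pointwise
(`IsRegular.geometricTerm_eq_formTerm`). The Hessian in y is split along the normal ν and the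
tangent space of the level set: the tangential block is the second fundamental form times w, and the
image of ν is ∇_y w (`IsRegular.quantK_sq_mul`). -/

theorem gradient_apply {ι : Type} [Fintype ι] [DecidableEq ι] (f : EuclideanSpace ℝ ι → ℝ)
    (X : EuclideanSpace ℝ ι) (b : ι) : gradient f X b = pd f b X := by
  have h : inner ℝ (gradient f X) (EuclideanSpace.single b (1 : ℝ))
      = fderiv ℝ f X (EuclideanSpace.single b 1) := by
    simp [gradient]
  rw [pd, ← h, EuclideanSpace.inner_single_right]
  simp

theorem fderiv_apply_eq_sum {ι : Type} [Fintype ι] [DecidableEq ι] (f : EuclideanSpace ℝ ι → ℝ)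
    (X v : EuclideanSpace ℝ ι) : fderiv ℝ f X v = ∑ b, v b * pd f b X := by
  have h : inner ℝ (gradient f X) v = fderiv ℝ f X v := by simp [gradient]
  rw [← h, PiLp.inner_apply]
  simp [gradient_apply, mul_comm]

theorem gradY_apply (f : E m d → ℝ) (X : E m d) (j : Fin d) :
    gradY f X j = pd f (Sum.inr j) X := rfl

theorem gradient_ne_zero_of_gradY_ne_zero {f : E m d → ℝ} {X : E m d} (h : gradY f X ≠ 0) :
    gradient f X ≠ 0 := by
  intro h0
  apply h
  ext j
  rw [gradY_apply, ← gradient_apply, h0]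
  rfl

theorem continuousOn_pd {U : Set (E m d)} (hU : IsOpen U) {f : E m d → ℝ}
    (hf : ContDiffOn ℝ 1 f U) (b : Fin m ⊕ Fin d) : ContinuousOn (pd f b) U :=
  (hf.continuousOn_fderiv_of_isOpen hU le_rfl).clm_apply continuousOn_const

theorem continuousOn_gradient {U : Set (E m d)} (hU : IsOpen U) {f : E m d → ℝ}
    (hf : ContDiffOn ℝ 1 f U) : ContinuousOn (gradient f) U :=
  (InnerProductSpace.toDual ℝ (E m d)).symm.continuous.comp_continuousOn
    (hf.continuousOn_fderiv_of_isOpen hU le_rfl)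

theorem continuousOn_gradY {U : Set (E m d)} (hU : IsOpen U) {f : E m d → ℝ}
    (hf : ContDiffOn ℝ 1 f U) : ContinuousOn (gradY f) U :=
  (PiLp.continuous_toLp 2 _).comp_continuousOn
    (continuousOn_pi.2 fun j => continuousOn_pd hU hf (Sum.inr j))

theorem contDiffOn_pd {U : Set (E m d)} (hU : IsOpen U) {f : E m d → ℝ}
    (hf : ContDiffOn ℝ 2 f U) (b : Fin m ⊕ Fin d) : ContDiffOn ℝ 1 (pd f b) U :=
  (hf.fderiv_of_isOpen hU (by norm_num)).clm_apply contDiffOn_const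

theorem contDiff_pd {f : E m d → ℝ} (hf : ContDiff ℝ ∞ f) (b : Fin m ⊕ Fin d) :
    ContDiff ℝ ∞ (pd f b) :=
  (hf.fderiv_right (by simp)).clm_apply contDiff_const

theorem tsupport_pd_subset (f : E m d → ℝ) (b : Fin m ⊕ Fin d) :
    tsupport (pd f b) ⊆ tsupport f :=
  tsupport_fderiv_apply_subset ℝ _

theorem IsTest.pd {Ω : Set (E m d)} {φ : E m d → ℝ} (hφ : IsTest Ω φ) (b : Fin m ⊕ Fin d) :
    IsTest Ω (pd φ b) :=
  ⟨contDiff_pd hφ.1 b, hφ.2.1.of_isClosed_subset (isClosed_tsupport _) (tsupport_pd_subset φ b),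
    (tsupport_pd_subset φ b).trans hφ.2.2⟩

theorem IsTest.mono {Ω U : Set (E m d)} {φ : E m d → ℝ} (hφ : IsTest U φ) (h : U ⊆ Ω) :
    IsTest Ω φ :=
  ⟨hφ.1, hφ.2.1, hφ.2.2.trans h⟩

/-- Symmetry of the second partial derivatives. -/
theorem pd_pd_comm {f : E m d → ℝ} {X : E m d} (hf : ContDiffAt ℝ 2 f X) (b c : Fin m ⊕ Fin d) :
    pd (pd f b) c X = pd (pd f c) b X := by
  have hs := hf.isSymmSndFDerivAt (by simp)
  have hd : DifferentiableAt ℝ (fderiv ℝ f) X :=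
    (hf.fderiv_right (m := 1) (by norm_num)).differentiableAt (by norm_num)
  have key : ∀ b c : Fin m ⊕ Fin d, pd (pd f b) c X
      = fderiv ℝ (fderiv ℝ f) X (EuclideanSpace.single c 1) (EuclideanSpace.single b 1) := by
    intro b c
    have h := (hd.hasFDerivAt.clm_apply
      (hasFDerivAt_const (EuclideanSpace.single b (1 : ℝ) : E m d) X)).fderiv
    change fderiv ℝ (fun Y => fderiv ℝ f Y (EuclideanSpace.single b 1)) X _ = _
    rw [h]
    simp
  rw [key, key]
  exact hs _ _

/-! ### Integration -/

/-- This is the shape of dominated convergence used in every limit below: whatever is merely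
integrable (matrix entries, second derivatives, F_{ij}) goes into the fixed factor f, and only
bounded factors vary. -/
theorem tendsto_integral_mul_of_bounded {α : Type*} [MeasurableSpace α] {μ : Measure α}
    {f : α → ℝ} (hf : Integrable f μ) {g : ℕ → α → ℝ} {h : α → ℝ} {C : ℝ}
    (hm : ∀ k, AEStronglyMeasurable (g k) μ) (hb : ∀ k, ∀ᵐ x ∂μ, |g k x| ≤ C)
    (ht : ∀ᵐ x ∂μ, Tendsto (fun k => g k x) atTop (𝓝 (h x))) :
    Tendsto (fun k => ∫ x, f x * g k x ∂μ) atTop (𝓝 (∫ x, f x * h x ∂μ)) := by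
  refine tendsto_integral_of_dominated_convergence (fun x => |f x| * C)
    (fun k => hf.aestronglyMeasurable.mul (hm k)) (hf.abs.mul_const C) (fun k => ?_) ?_
  · filter_upwards [hb k] with x hx
    rw [Real.norm_eq_abs, abs_mul]
    exact mul_le_mul_of_nonneg_left hx (abs_nonneg _)
  · filter_upwards [ht] with x hx
    exact hx.const_mul _

theorem LocallyIntegrableOn.integrable_mul_of_tsupport {U : Set (E m d)} {f g : E m d → ℝ}
    (hf : LocallyIntegrableOn f U) (hg : ContinuousOn g U) (hc : HasCompactSupport g)
    (hs : tsupport g ⊆ U) : Integrable (fun X => f X * g X) := by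
  have h := (hf.integrableOn_compact_subset hs hc).mul_continuousOn (hg.mono hs) hc
  refine (integrableOn_iff_integrable_of_support_subset fun X hX => ?_).1 h
  by_contra hn
  exact hX (by simp [image_eq_zero_of_notMem_tsupport hn])

/-- Integration by parts against a compactly supported function, for a function that is only
differentiable along one coordinate direction. -/
theorem integral_mul_pd_eq_neg {U : Set (E m d)} {f f' φ : E m d → ℝ} (b : Fin m ⊕ Fin d)
    (hφ : ContDiff ℝ 1 φ) (hc : HasCompactSupport φ) (hs : tsupport φ ⊆ U)
    (hf : LocallyIntegrableOn f U) (hf' : LocallyIntegrableOn f' U)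
    (hd : ∀ X ∈ U, HasLineDerivAt ℝ f (f' X) X (EuclideanSpace.single b 1)) :
    ∫ X, f X * pd φ b X = - ∫ X, f' X * φ X := by
  have hpd : Continuous (pd φ b) := (hφ.continuous_fderiv (by norm_num)).clm_apply continuous_const
  have hpc : HasCompactSupport (pd φ b) :=
    hc.of_isClosed_subset (isClosed_tsupport _) (tsupport_pd_subset φ b)
  refine integral_bilinear_hasLineDerivAt_right_eq_neg_left_of_integrable (μ := volume)
    (B := ContinuousLinearMap.mul ℝ ℝ) (v := EuclideanSpace.single b (1 : ℝ))
    (f := f) (f' := f') (g := φ) (g' := pd φ b) ?_ ?_ ?_ (fun X hX => hd X (hs hX)) ?_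
  · exact LocallyIntegrableOn.integrable_mul_of_tsupport hf' hφ.continuous.continuousOn hc hs
  · exact LocallyIntegrableOn.integrable_mul_of_tsupport hf hpd.continuousOn hpc
      ((tsupport_pd_subset φ b).trans hs)
  · exact LocallyIntegrableOn.integrable_mul_of_tsupport hf hφ.continuous.continuousOn hc hs
  · intro X _
    exact ((hφ.differentiable (by norm_num)) X).hasFDerivAt.hasLineDerivAt _

/-- A compactly supported `C^1` function is approximated by test functions, boundedly in `C^1` and
with supports in a common compact set. -/
theorem exists_isTest_tendsto {U : Set (E m d)} (hU : IsOpen U) {φ : E m d → ℝ}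
    (hφ : ContDiff ℝ 1 φ) (hc : HasCompactSupport φ) (hs : tsupport φ ⊆ U) :
    ∃ (f : ℕ → E m d → ℝ) (K : Set (E m d)) (C : ℝ), IsCompact K ∧ K ⊆ U ∧ tsupport φ ⊆ K ∧
      (∀ k, IsTest U (f k)) ∧ (∀ k, tsupport (f k) ⊆ K) ∧
      (∀ k X, |f k X| ≤ C) ∧ (∀ k b X, |pd (f k) b X| ≤ C) ∧
      (∀ X, Tendsto (fun k => f k X) atTop (𝓝 (φ X))) ∧
      (∀ b X, Tendsto (fun k => pd (f k) b X) atTop (𝓝 (pd φ b X))) := by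
  obtain ⟨δ, hδ, hδU⟩ := hc.isCompact.exists_cthickening_subset_open hU hs
  have hr : ∀ k : ℕ, 0 < δ / (k + 2 : ℝ) := fun k => by positivity
  let ρ : ℕ → ContDiffBump (0 : E m d) := fun k =>
    { rIn := δ / (k + 2) / 2, rOut := δ / (k + 2), rIn_pos := by positivity,
      rIn_lt_rOut := half_lt_self (hr k) }
  have hρ0 : Tendsto (fun k => (ρ k).rOut) atTop (𝓝 0) :=
    tendsto_const_nhds.div_atTop (tendsto_natCast_atTop_atTop.atTop_add tendsto_const_nhds)
  have hρδ : ∀ k, (ρ k).rOut ≤ δ := fun k => by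
    refine div_le_self hδ.le ?_
    have : (0 : ℝ) ≤ k := k.cast_nonneg
    linarith
  let L := ContinuousLinearMap.lsmul ℝ ℝ (E := ℝ)
  let f : ℕ → E m d → ℝ := fun k => convolution ((ρ k).normed volume) φ L volume
  have hpdc : ∀ b, Continuous (pd φ b) := fun b =>
    (hφ.continuous_fderiv (by norm_num)).clm_apply continuous_const
  have hpcs : ∀ b, HasCompactSupport (pd φ b) := fun b =>
    hc.of_isClosed_subset (isClosed_tsupport _) (tsupport_pd_subset φ b)
  -- The derivative falls on φ rather than on the bump, so partial derivatives of the mollification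
  -- are mollifications of partial derivatives, and one bound and one limit argument serve both.
  have hpd : ∀ k b X, pd (f k) b X
      = convolution ((ρ k).normed volume) (pd φ b) L volume X := by
    intro k b X
    have h := (hc.hasFDerivAt_convolution_right L (μ := volume)
      ((ρ k).integrable_normed.locallyIntegrable) hφ X).fderiv
    rw [pd, h]
    exact convolution_precompR_apply L ((ρ k).integrable_normed.locallyIntegrable)
      (hc.fderiv ℝ) (hφ.continuous_fderiv (by norm_num)) X _
  have hbound : ∀ g : E m d → ℝ, Continuous g → HasCompactSupport g →
      ∃ C : ℝ, ∀ k X, |convolution ((ρ k).normed volume) g L volume X| ≤ C := by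
    intro g hg hgc
    obtain ⟨C, hC⟩ := hgc.exists_bound_of_continuous hg
    -- The oscillation of g is at most 2C, hence so is the distance from the mollification to g;
    -- adding |g| ≤ C gives the bound.
    refine ⟨2 * C + C, fun k X => ?_⟩
    have h := (ρ k).dist_normed_convolution_le (μ := volume) (g := g) (x₀ := X) (ε := 2 * C)
      hg.aestronglyMeasurable (fun Y _ => by
        rw [dist_eq_norm]
        exact (norm_sub_le _ _).trans (by linarith [hC X, hC Y]))
    rw [Real.dist_eq] at h
    have h1 := abs_sub_abs_le_abs_sub (convolution ((ρ k).normed volume) g L volume X) (g X)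
    have h2 := hC X
    rw [Real.norm_eq_abs] at h2
    linarith
  have hsupp : ∀ k, tsupport (f k) ⊆ Metric.cthickening δ (tsupport φ) := by
    intro k
    refine closure_minimal ?_ Metric.isClosed_cthickening
    refine (support_convolution_subset L).trans ?_
    rintro _ ⟨Y, hY, Z, hZ, rfl⟩
    rw [(ρ k).support_normed_eq, mem_ball_zero_iff] at hY
    refine Metric.mem_cthickening_of_dist_le _ Z δ _ (subset_tsupport _ hZ) ?_
    rw [dist_eq_norm]
    simpa using hY.le.trans (hρδ k)
  have hK : IsCompact (Metric.cthickening δ (tsupport φ)) := hc.isCompact.cthickening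
  obtain ⟨C₀, hC₀⟩ := hbound φ hφ.continuous hc
  choose C₁ hC₁ using fun b => hbound (pd φ b) (hpdc b) (hpcs b)
  refine ⟨f, Metric.cthickening δ (tsupport φ), |C₀| + ∑ b, |C₁ b|, hK, hδU,
    Metric.self_subset_cthickening _, fun k => ⟨?_, ?_, (hsupp k).trans hδU⟩, hsupp, ?_, ?_, ?_, ?_⟩
  · exact (ρ k).hasCompactSupport_normed.contDiff_convolution_left L
      ((ρ k).contDiff_normed (n := ⊤)) hφ.continuous.locallyIntegrable
  · exact hK.of_isClosed_subset (isClosed_tsupport _) (hsupp k)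
  · intro k X
    have : 0 ≤ ∑ b, |C₁ b| := Finset.sum_nonneg fun b _ => abs_nonneg _
    linarith [hC₀ k X, le_abs_self C₀]
  · intro k b X
    rw [hpd]
    have := Finset.single_le_sum (f := fun b => |C₁ b|) (fun b _ => abs_nonneg _)
      (Finset.mem_univ b)
    linarith [hC₁ b k X, le_abs_self (C₁ b), abs_nonneg C₀]
  · intro X
    exact ContDiffBump.convolution_tendsto_right_of_continuous hρ0 hφ.continuous X
  · intro b X
    simp_rw [hpd]
    exact ContDiffBump.convolution_tendsto_right_of_continuous hρ0 (hpdc b) X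

/-! ### The quadratic form -/

theorem formA_eq_sum (a : EuclideanSpace ℝ (Fin m) → ℝ → ℝ) (u : E m d → ℝ) (X v w : E m d) :
    formA a u X v w
      = ∑ i, ∑ j, coeffMatrix a (xPart X) (gradient u X) i j * (v j * w i) := by
  rw [formA, PiLp.inner_apply]
  refine Finset.sum_congr rfl fun i _ => ?_
  simp only [Matrix.toLpLin_apply, Matrix.mulVec, dotProduct, RCLike.inner_apply,
    conj_trivial, Finset.mul_sum]
  exact Finset.sum_congr rfl fun j _ => by ring

/-- The matrix is a multiple of the identity plus a rank-one matrix along ∇u, which makes the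
symmetry of the form visible. The formula persists at ∇u = 0, where the rank-one part vanishes on
both sides. -/
theorem formA_eq (a : EuclideanSpace ℝ (Fin m) → ℝ → ℝ) (u : E m d → ℝ) (X v w : E m d) :
    formA a u X v w = a (xPart X) ‖gradient u X‖ * inner ℝ v w
      + deriv (a (xPart X)) ‖gradient u X‖ / ‖gradient u X‖
        * (inner ℝ (gradient u X) v * inner ℝ (gradient u X) w) := by
  rw [formA_eq_sum]
  simp only [coeffMatrix, Matrix.of_apply, add_mul, Finset.sum_add_distrib, PiLp.inner_apply,
    RCLike.inner_apply, conj_trivial, Finset.mul_sum]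
  congr 1
  · refine Finset.sum_congr rfl fun i _ => ?_
    rw [Finset.sum_eq_single i]
    · simp [mul_comm]
    · intro j _ hj
      simp [Ne.symm hj]
    · simp
  · refine Finset.sum_congr rfl fun i _ => ?_
    rw [Finset.sum_mul, Finset.mul_sum]
    exact Finset.sum_congr rfl fun j _ => by ring

theorem formA_comm (a : EuclideanSpace ℝ (Fin m) → ℝ → ℝ) (u : E m d → ℝ) (X v w : E m d) :
    formA a u X v w = formA a u X w v := by
  rw [formA_eq, formA_eq, real_inner_comm, mul_comm (inner ℝ (gradient u X) v)]

theorem formA_add_right (a : EuclideanSpace ℝ (Fin m) → ℝ → ℝ) (u : E m d → ℝ) (X v w z : E m d) :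
    formA a u X v (w + z) = formA a u X v w + formA a u X v z := by
  simp only [formA, inner_add_right]

theorem formA_smul_right (a : EuclideanSpace ℝ (Fin m) → ℝ → ℝ) (u : E m d → ℝ) (X v w : E m d)
    (c : ℝ) : formA a u X v (c • w) = c * formA a u X v w := by
  simp only [formA, inner_smul_right]

theorem formA_add_left (a : EuclideanSpace ℝ (Fin m) → ℝ → ℝ) (u : E m d → ℝ) (X v w z : E m d) :
    formA a u X (v + w) z = formA a u X v z + formA a u X w z := by
  rw [formA_comm, formA_add_right, formA_comm, formA_comm a u X z w]

theorem formA_smul_left (a : EuclideanSpace ℝ (Fin m) → ℝ → ℝ) (u : E m d → ℝ) (X v w : E m d)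
    (c : ℝ) : formA a u X (c • v) w = c * formA a u X v w := by
  rw [formA_comm, formA_smul_right, formA_comm]

theorem formA_sum_left {ι : Type*} (s : Finset ι) (a : EuclideanSpace ℝ (Fin m) → ℝ → ℝ)
    (u : E m d → ℝ) (X : E m d) (v : ι → E m d) (w : E m d) :
    formA a u X (∑ j ∈ s, v j) w = ∑ j ∈ s, formA a u X (v j) w := by
  simp only [formA, map_sum, sum_inner]

/-! ### The noncritical set and the regular set -/

/-- The set `{X ∈ Ω | ∇u(X) ≠ 0}`. -/
def noncriticalSet (Ω : Set (E m d)) (u : E m d → ℝ) : Set (E m d) :=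
  {X | X ∈ Ω ∧ gradient u X ≠ 0}

theorem noncriticalSet_subset (Ω : Set (E m d)) (u : E m d → ℝ) : noncriticalSet Ω u ⊆ Ω :=
  fun _ hX => hX.1

theorem regularSet_subset (Ω : Set (E m d)) (u : E m d → ℝ) : regularSet Ω u ⊆ Ω :=
  fun _ hX => hX.1

theorem regularSet_subset_noncriticalSet (Ω : Set (E m d)) (u : E m d → ℝ) :
    regularSet Ω u ⊆ noncriticalSet Ω u :=
  fun _ hX => ⟨hX.1, gradient_ne_zero_of_gradY_ne_zero hX.2⟩

theorem IsRegular.isOpen_noncriticalSet {Ω : Set (E m d)} {u : E m d → ℝ} (hu : IsRegular Ω u)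
    (hΩ : IsOpen Ω) : IsOpen (noncriticalSet Ω u) :=
  (continuousOn_gradient hΩ hu.contDiffOn_one).isOpen_inter_preimage hΩ isOpen_compl_singleton

theorem IsRegular.isOpen_regularSet {Ω : Set (E m d)} {u : E m d → ℝ} (hu : IsRegular Ω u)
    (hΩ : IsOpen Ω) : IsOpen (regularSet Ω u) :=
  (continuousOn_gradY hΩ hu.contDiffOn_one).isOpen_inter_preimage hΩ isOpen_compl_singleton

theorem IsRegular.contDiffOn_pd_noncriticalSet {Ω : Set (E m d)} {u : E m d → ℝ}
    (hu : IsRegular Ω u) (hΩ : IsOpen Ω) (b : Fin m ⊕ Fin d) :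
    ContDiffOn ℝ 1 (pd u b) (noncriticalSet Ω u) :=
  contDiffOn_pd (hu.isOpen_noncriticalSet hΩ) hu.contDiffOn_two b

theorem IsRegular.continuousOn_normGradY {Ω : Set (E m d)} {u : E m d → ℝ}
    (hu : IsRegular Ω u) (hΩ : IsOpen Ω) : ContinuousOn (normGradY u) Ω :=
  (continuousOn_gradY hΩ hu.contDiffOn_one).norm

theorem normGradY_sq (u : E m d → ℝ) (X : E m d) :
    normGradY u X ^ 2 = ∑ j : Fin d, pd u (Sum.inr j) X ^ 2 := by
  rw [normGradY, EuclideanSpace.norm_sq_eq]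
  simp [gradY_apply]

theorem normGradY_nonneg (u : E m d → ℝ) (X : E m d) : 0 ≤ normGradY u X := norm_nonneg _

theorem normGradY_pos {Ω : Set (E m d)} {u : E m d → ℝ} {X : E m d} (hX : X ∈ regularSet Ω u) :
    0 < normGradY u X :=
  norm_pos_iff.2 hX.2

theorem normGradY_le_norm_gradient (u : E m d → ℝ) (X : E m d) :
    normGradY u X ≤ ‖gradient u X‖ := by
  refine le_of_sq_le_sq ?_ (norm_nonneg _)
  rw [normGradY_sq, EuclideanSpace.norm_sq_eq, Fintype.sum_sum_type]
  have : 0 ≤ ∑ i : Fin m, ‖gradient u X (Sum.inl i)‖ ^ 2 :=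
    Finset.sum_nonneg fun i _ => sq_nonneg _
  simp only [gradient_apply, Real.norm_eq_abs, sq_abs] at this ⊢
  linarith

theorem abs_pd_le_normGradY (u : E m d → ℝ) (j : Fin d) (X : E m d) :
    |pd u (Sum.inr j) X| ≤ normGradY u X := by
  rw [← gradY_apply, ← Real.norm_eq_abs]
  exact PiLp.norm_apply_le _ _

theorem IsRegular.contDiffOn_normGradY {Ω : Set (E m d)} {u : E m d → ℝ}
    (hu : IsRegular Ω u) (hΩ : IsOpen Ω) : ContDiffOn ℝ 1 (normGradY u) (regularSet Ω u) := by
  have h : ContDiffOn ℝ 1 (gradY u) (regularSet Ω u) :=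
    contDiffOn_euclidean.2 fun j => (hu.contDiffOn_pd_noncriticalSet hΩ (Sum.inr j)).mono
      (regularSet_subset_noncriticalSet Ω u)
  exact h.norm ℝ fun X hX => hX.2

/-- `|∇_y u| ∇|∇_y u| = ∑_j u_{y_j} ∇u_{y_j}`. -/
theorem IsRegular.normGradY_smul_gradient {Ω : Set (E m d)} {u : E m d → ℝ}
    (hu : IsRegular Ω u) (hΩ : IsOpen Ω) {X : E m d} (hX : X ∈ regularSet Ω u) :
    normGradY u X • gradient (normGradY u) X
      = ∑ j : Fin d, pd u (Sum.inr j) X • gradient (pd u (Sum.inr j)) X := by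
  have hw : DifferentiableAt ℝ (normGradY u) X :=
    ((hu.contDiffOn_normGradY hΩ).contDiffAt ((hu.isOpen_regularSet hΩ).mem_nhds hX)).differentiableAt
      (by norm_num)
  have hj : ∀ j : Fin d, DifferentiableAt ℝ (pd u (Sum.inr j)) X := fun j =>
    ((hu.contDiffOn_pd_noncriticalSet hΩ (Sum.inr j)).contDiffAt
      ((hu.isOpen_noncriticalSet hΩ).mem_nhds
        (regularSet_subset_noncriticalSet Ω u hX))).differentiableAt (by norm_num)
  have h1 := hw.hasFDerivAt.pow 2
  have h2 := HasFDerivAt.fun_sum (u := Finset.univ) fun j _ => (hj j).hasFDerivAt.pow 2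
  have h3 : (fun Y => normGradY u Y ^ 2) = fun Y => ∑ j : Fin d, pd u (Sum.inr j) Y ^ 2 :=
    funext fun Y => normGradY_sq u Y
  -- Both sides of |∇_y u|² = ∑_j u_{y_j}² are differentiated; the square avoids differentiating the
  -- norm explicitly, and the common factor 2 is cancelled at the end.
  have h4 := h1.unique (h3 ▸ h2)
  ext b
  have h5 := congrArg (fun L => L (EuclideanSpace.single b (1 : ℝ))) h4
  simp only [WithLp.ofLp_sum, Finset.sum_apply, PiLp.smul_apply, smul_eq_mul, gradient_apply]
  simp only [Nat.cast_ofNat, Nat.add_one_sub_one, pow_one, smul_apply,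
    sum_apply, smul_eq_mul, mul_assoc, ← Finset.mul_sum, nsmul_eq_mul] at h5
  exact mul_left_cancel₀ two_ne_zero h5

/-! ### Integrability -/

theorem BoundedMatrix.memLp {Ω S : Set (E m d)} {a : EuclideanSpace ℝ (Fin m) → ℝ → ℝ}
    {u : E m d → ℝ} (hA : BoundedMatrix Ω a u) (hS : S ⊆ noncriticalSet Ω u)
    (hb : Bornology.IsBounded S) (i j : Fin m ⊕ Fin d) :
    MemLp (fun X => coeffMatrix a (xPart X) (gradient u X) i j) ⊤ (volume.restrict S) := by
  obtain ⟨R, hR, hSR⟩ := hb.subset_ball_lt 0 0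
  exact (hA R hR i j).mono_measure (Measure.restrict_mono (subset_inter hS hSR) le_rfl)

theorem BoundedMatrix.integrableOn {Ω S : Set (E m d)} {a : EuclideanSpace ℝ (Fin m) → ℝ → ℝ}
    {u : E m d → ℝ} (hA : BoundedMatrix Ω a u) (hS : S ⊆ noncriticalSet Ω u)
    (hb : Bornology.IsBounded S) (i j : Fin m ⊕ Fin d) :
    IntegrableOn (fun X => coeffMatrix a (xPart X) (gradient u X) i j) S := by
  have : IsFiniteMeasure (volume.restrict S) :=
    ⟨by rw [Measure.restrict_apply_univ]; exact hb.measure_lt_top⟩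
  exact (hA.memLp hS hb i j).integrable le_top

/-- Hölder with exponents ∞, 2, 2, entry by entry. Boundedness of S is what makes the local L^∞
bound on 𝒜 available. -/
theorem BoundedMatrix.integrableOn_formA {Ω S : Set (E m d)}
    {a : EuclideanSpace ℝ (Fin m) → ℝ → ℝ} {u : E m d → ℝ} (hA : BoundedMatrix Ω a u)
    (hS : S ⊆ noncriticalSet Ω u) (hb : Bornology.IsBounded S) {v w : E m d → E m d}
    (hv : ∀ b, MemLp (fun X => v X b) 2 (volume.restrict S))
    (hw : ∀ b, MemLp (fun X => w X b) 2 (volume.restrict S)) :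
    IntegrableOn (fun X => formA a u X (v X) (w X)) S := by
  simp_rw [formA_eq_sum]
  refine integrable_finsetSum _ fun i _ => integrable_finsetSum _ fun j _ => ?_
  exact ((hv j).integrable_mul (hw i)).mul_of_top_right (hA.memLp hS hb i j)

theorem IntegrableOn.mul_of_tsupport_subset {S K : Set (E m d)} {f h : E m d → ℝ}
    (hS : MeasurableSet S) (hf : IntegrableOn f (S ∩ K)) (hh : Continuous h)
    (hc : HasCompactSupport h) (hK : tsupport h ⊆ K) : IntegrableOn (fun X => f X * h X) S := by
  obtain ⟨C, hC⟩ := hc.exists_bound_of_continuous hh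
  have h1 : IntegrableOn (fun X => f X * h X) (S ∩ K) :=
    Integrable.mul_bdd hf hh.aestronglyMeasurable (ae_of_all _ hC)
  refine h1.of_forall_sdiff_eq_zero hS fun X hX => ?_
  have : X ∉ tsupport h := fun hx => hX.2 ⟨hX.1, hK hx⟩
  rw [image_eq_zero_of_notMem_tsupport this, mul_zero]

/-- On the noncritical set the classical second derivatives are the weak ones, hence locally
square integrable up to the critical set. -/
theorem IsRegular.memLp_pd_pd {Ω K S : Set (E m d)} {u : E m d → ℝ} (hu : IsRegular Ω u)
    (hΩ : IsOpen Ω) (hK : IsCompact K) (hKΩ : K ⊆ Ω) (hS : MeasurableSet S)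
    (hSG : S ⊆ noncriticalSet Ω u) (hSK : S ⊆ K) (b c : Fin m ⊕ Fin d) :
    MemLp (pd (pd u b) c) 2 (volume.restrict S) := by
  obtain ⟨hL, hW⟩ := hu.gradient_memW12loc b
  obtain ⟨g, hg, hgw⟩ := hW c
  have hGo := hu.isOpen_noncriticalSet hΩ
  have hC1 := hu.contDiffOn_pd_noncriticalSet hΩ b
  have hgloc : LocallyIntegrableOn g (noncriticalSet Ω u) := by
    rw [locallyIntegrableOn_iff hGo.isLocallyClosed]
    intro K' hK'G hK'
    have : IsFiniteMeasure (volume.restrict K') :=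
      ⟨by rw [Measure.restrict_apply_univ]; exact hK'.measure_lt_top⟩
    exact (hg K' hK' (hK'G.trans (noncriticalSet_subset Ω u))).integrable (by norm_num)
  have hploc : LocallyIntegrableOn (pd (pd u b) c) (noncriticalSet Ω u) :=
    (continuousOn_pd hGo hC1 c).locallyIntegrableOn hGo.measurableSet
  have huloc : LocallyIntegrableOn (pd u b) (noncriticalSet Ω u) :=
    hC1.continuousOn.locallyIntegrableOn hGo.measurableSet
  -- The weak derivative g and the classical one have the same integrals against test functions
  -- supported in the open noncritical set, so they agree almost everywhere there. The L² bound of g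
  -- on K is then inherited, although S may reach the critical set.
  have hae : ∀ᵐ X, X ∈ noncriticalSet Ω u → g X - pd (pd u b) c X = 0 := by
    refine hGo.ae_eq_zero_of_integral_contDiff_smul_eq_zero (hgloc.sub hploc)
      fun φ hφ hφc hφs => ?_
    have hφt : IsTest (noncriticalSet Ω u) φ := ⟨hφ, hφc, hφs⟩
    have h1 := hgw φ (hφt.mono (noncriticalSet_subset Ω u))
    have h2 := integral_mul_pd_eq_neg c (hφ.of_le (by exact_mod_cast le_top)) hφc hφs huloc hploc
      (fun X hX => (((hC1.contDiffAt (hGo.mem_nhds hX)).differentiableAt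
        (by norm_num)).hasFDerivAt).hasLineDerivAt _)
    have hsub := hφs.trans (noncriticalSet_subset Ω u)
    rw [setIntegral_eq_integral_of_forall_compl_eq_zero, setIntegral_eq_integral_of_forall_compl_eq_zero,
      h2, neg_inj] at h1
    · simp only [smul_eq_mul, mul_sub]
      rw [integral_sub]
      · simp only [mul_comm (φ _), h1, sub_self]
      · simpa only [mul_comm] using
          LocallyIntegrableOn.integrable_mul_of_tsupport hgloc hφ.continuous.continuousOn hφc hφs
      · simpa only [mul_comm] using
          LocallyIntegrableOn.integrable_mul_of_tsupport hploc hφ.continuous.continuousOn hφc hφs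
    · intro X hX
      rw [image_eq_zero_of_notMem_tsupport (fun h => hX (hsub h)), mul_zero]
    · intro X hX
      rw [image_eq_zero_of_notMem_tsupport (fun h => hX (hsub (tsupport_pd_subset φ c h))), mul_zero]
  have h3 : MemLp g 2 (volume.restrict S) :=
    (hg K hK hKΩ).mono_measure (Measure.restrict_mono hSK le_rfl)
  refine h3.ae_eq ?_
  filter_upwards [ae_restrict_of_ae hae, ae_restrict_mem hS] with X hX hXS
  linarith [hX (hSG hXS)]

/-- Dividing |∇_y u| ∂_b|∇_y u| = ∑_j u_{y_j} ∂_b u_{y_j} by |∇_y u| and using |u_{y_j}| ≤ |∇_y u|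
gives |∂_b|∇_y u|| ≤ ∑_j |∂_b u_{y_j}|. This bound does not degenerate where ∇_y u tends to 0. -/
theorem IsRegular.memLp_gradient_normGradY {Ω K S : Set (E m d)} {u : E m d → ℝ}
    (hu : IsRegular Ω u) (hΩ : IsOpen Ω) (hK : IsCompact K) (hKΩ : K ⊆ Ω) (hS : MeasurableSet S)
    (hSR : S ⊆ regularSet Ω u) (hSK : S ⊆ K) (b : Fin m ⊕ Fin d) :
    MemLp (fun X => gradient (normGradY u) X b) 2 (volume.restrict S) := by
  have hb : MemLp (fun X => ∑ j : Fin d, |pd (pd u (Sum.inr j)) b X|) 2 (volume.restrict S) :=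
    memLp_finsetSum _ fun j _ => (hu.memLp_pd_pd hΩ hK hKΩ hS
      (hSR.trans (regularSet_subset_noncriticalSet Ω u)) hSK (Sum.inr j) b).abs
  refine hb.mono ?_ ?_
  · simp_rw [gradient_apply]
    exact ((continuousOn_pd (hu.isOpen_regularSet hΩ) (hu.contDiffOn_normGradY hΩ) b).mono
      hSR).aestronglyMeasurable hS
  · filter_upwards [ae_restrict_mem hS] with X hX
    have h := congrArg (fun v : E m d => v b) (hu.normGradY_smul_gradient hΩ (hSR hX))
    simp only [WithLp.ofLp_sum, Finset.sum_apply, PiLp.smul_apply, smul_eq_mul,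
      gradient_apply] at h
    have hpos := normGradY_pos (hSR hX)
    rw [gradient_apply, Real.norm_eq_abs, Real.norm_eq_abs]
    refine le_trans ?_ (le_abs_self _)
    refine le_of_mul_le_mul_left ?_ hpos
    calc normGradY u X * |pd (normGradY u) b X| = |normGradY u X * pd (normGradY u) b X| := by
          rw [abs_mul, abs_of_pos hpos]
      _ ≤ ∑ j : Fin d, |pd u (Sum.inr j) X * pd (pd u (Sum.inr j)) b X| := by
          rw [h]; exact Finset.abs_sum_le_sum_abs _ _
      _ ≤ normGradY u X * ∑ j : Fin d, |pd (pd u (Sum.inr j)) b X| := by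
          rw [Finset.mul_sum]
          refine Finset.sum_le_sum fun j _ => ?_
          rw [abs_mul]
          exact mul_le_mul_of_nonneg_right (abs_pd_le_normGradY u j X) (abs_nonneg _)

theorem memLp_gradient_of_contDiff {S : Set (E m d)} {φ : E m d → ℝ} (hφ : ContDiff ℝ 1 φ)
    (hc : HasCompactSupport φ) (b : Fin m ⊕ Fin d) :
    MemLp (fun X => gradient φ X b) 2 (volume.restrict S) := by
  simp_rw [gradient_apply]
  have hpd : Continuous (pd φ b) := (hφ.continuous_fderiv (by norm_num)).clm_apply continuous_const
  exact (hpd.memLp_of_hasCompactSupport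
    (hc.of_isClosed_subset (isClosed_tsupport _) (tsupport_pd_subset φ b))).restrict S

/-! ### The linearized equation -/

/-- Lines in a y-direction leave x fixed. Hence no regularity of a or F in x enters when the
equation is differentiated, and line derivatives are used in place of full ones. -/
theorem xPart_add_smul_single_inr (X : E m d) (t : ℝ) (j : Fin d) :
    xPart (X + t • EuclideanSpace.single (Sum.inr j) (1 : ℝ)) = xPart X := by
  ext i
  simp [xPart]

theorem IsRegular.pd_norm_gradient {Ω : Set (E m d)} {u : E m d → ℝ}
    (hu : IsRegular Ω u) (hΩ : IsOpen Ω) {X : E m d} (hX : X ∈ noncriticalSet Ω u)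
    (b : Fin m ⊕ Fin d) :
    DifferentiableAt ℝ (fun Y => ‖gradient u Y‖) X ∧
      ‖gradient u X‖ * pd (fun Y => ‖gradient u Y‖) b X = ∑ c, pd u c X * pd (pd u c) b X := by
  have hGo := hu.isOpen_noncriticalSet hΩ
  have hj : ∀ c, ContDiffAt ℝ 1 (pd u c) X := fun c =>
    (hu.contDiffOn_pd_noncriticalSet hΩ c).contDiffAt (hGo.mem_nhds hX)
  have hg : ContDiffAt ℝ 1 (gradient u) X :=
    contDiffAt_euclidean.2 fun c => by simpa only [gradient_apply] using hj c
  have hw : DifferentiableAt ℝ (fun Y => ‖gradient u Y‖) X :=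
    (hg.norm ℝ hX.2).differentiableAt (by norm_num)
  refine ⟨hw, ?_⟩
  have h1 := hw.hasFDerivAt.pow 2
  have h2 := HasFDerivAt.fun_sum (u := Finset.univ) fun c _ =>
    ((hj c).differentiableAt (by norm_num)).hasFDerivAt.pow 2
  have h3 : (fun Y => ‖gradient u Y‖ ^ 2) = fun Y => ∑ c, pd u c Y ^ 2 :=
    funext fun Y => by simp [EuclideanSpace.norm_sq_eq, gradient_apply]
  have h5 := congrArg (fun L => L (EuclideanSpace.single b (1 : ℝ))) (h1.unique (h3 ▸ h2))
  simp only [Nat.cast_ofNat, Nat.add_one_sub_one, pow_one, smul_apply,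
    sum_apply, smul_eq_mul, mul_assoc, ← Finset.mul_sum, nsmul_eq_mul] at h5
  exact mul_left_cancel₀ two_ne_zero h5

/-- The derivative of the flux `a(x, |∇u|) ∇u` in `y_j` is `𝒜 ∇u_{y_j}`. -/
theorem IsRegular.hasLineDerivAt_flux {Ω : Set (E m d)} {a : EuclideanSpace ℝ (Fin m) → ℝ → ℝ}
    {u : E m d → ℝ} (hu : IsRegular Ω u) (ha : IsCoefficient a) (hΩ : IsOpen Ω) {X : E m d}
    (hX : X ∈ noncriticalSet Ω u) (b : Fin m ⊕ Fin d) (j : Fin d) :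
    HasLineDerivAt ℝ (fun Y => a (xPart Y) ‖gradient u Y‖ * pd u b Y)
      (∑ c, coeffMatrix a (xPart X) (gradient u X) b c * pd (pd u (Sum.inr j)) c X) X
      (EuclideanSpace.single (Sum.inr j) 1) := by
  have hGo := hu.isOpen_noncriticalSet hΩ
  obtain ⟨hN, hN'⟩ := hu.pd_norm_gradient hΩ hX (Sum.inr j)
  have hpos : 0 < ‖gradient u X‖ := norm_pos_iff.2 hX.2
  have hb : DifferentiableAt ℝ (pd u b) X :=
    ((hu.contDiffOn_pd_noncriticalSet hΩ b).contDiffAt (hGo.mem_nhds hX)).differentiableAt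
      (by norm_num)
  have hNl := hN.hasFDerivAt.hasLineDerivAt (EuclideanSpace.single (Sum.inr j) (1 : ℝ))
  have hbl := hb.hasFDerivAt.hasLineDerivAt (EuclideanSpace.single (Sum.inr j) (1 : ℝ))
  have had : HasDerivAt (a (xPart X)) (deriv (a (xPart X)) ‖gradient u X‖) ‖gradient u X‖ :=
    (((ha.contDiffOn (xPart X)).contDiffAt (Ioi_mem_nhds hpos)).differentiableAt
      (by norm_num)).hasDerivAt
  unfold HasLineDerivAt at hNl hbl ⊢
  have hcomp := (HasDerivAt.scomp (g₁ := a (xPart X))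
    (g₁' := deriv (a (xPart X)) ‖gradient u X‖) (0 : ℝ)
    (by simp only [zero_smul, add_zero]; exact had) hNl).mul hbl
  simp only [xPart_add_smul_single_inr]
  refine hcomp.congr_deriv ?_
  have hsymm : ∀ c, pd (pd u c) (Sum.inr j) X = pd (pd u (Sum.inr j)) c X := fun c =>
    pd_pd_comm (hu.contDiffOn_two.contDiffAt (hGo.mem_nhds hX)) c (Sum.inr j)
  simp only [hsymm] at hN'
  have hN'' : pd (fun Y => ‖gradient u Y‖) (Sum.inr j) X
      = (∑ c, pd u c X * pd (pd u (Sum.inr j)) c X) / ‖gradient u X‖ := by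
    rw [eq_div_iff hpos.ne', mul_comm, hN']
  change (fderiv ℝ (fun Y => ‖gradient u Y‖) X (EuclideanSpace.single (Sum.inr j) 1)
      • deriv (a (xPart X)) ‖gradient u X‖) * pd u b (X + (0 : ℝ) • _)
    + a (xPart X) ‖gradient u (X + (0 : ℝ) • _)‖ * pd (pd u b) (Sum.inr j) X = _
  rw [zero_smul, add_zero, hsymm b]
  change (pd (fun Y => ‖gradient u Y‖) (Sum.inr j) X • _) * _ + _ = _
  rw [hN'', smul_eq_mul]
  simp only [coeffMatrix, Matrix.of_apply, gradient_apply, add_mul, Finset.sum_add_distrib]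
  rw [add_comm]
  congr 1
  · simp
  · rw [Finset.sum_div, Finset.sum_mul, Finset.sum_mul]
    exact Finset.sum_congr rfl fun c _ => by ring

/-- The derivative of `F_k(x, u)` in `y_j` is `∑_i F_{ki} u^i_{y_j}`. -/
theorem hasLineDerivAt_F1 {Ω : Set (E m d)}
    {F : EuclideanSpace ℝ (Fin m) → EuclideanSpace ℝ (Fin n) → ℝ} (hF : ∀ x, ContDiff ℝ 2 (F x))
    {u : Fin n → E m d → ℝ} (hΩ : IsOpen Ω) (hu : ∀ i, ContDiffOn ℝ 1 (u i) Ω) {X : E m d}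
    (hX : X ∈ Ω) (k : Fin n) (j : Fin d) :
    HasLineDerivAt ℝ (F1 F u k) (∑ i, F2 F u k i X * pd (u i) (Sum.inr j) X) X
      (EuclideanSpace.single (Sum.inr j) 1) := by
  have hpd : DifferentiableAt ℝ (pd (F (xPart X)) k) (tuple u X) :=
    ((((hF (xPart X)).fderiv_right (m := 1) (by norm_num)).clm_apply
      contDiff_const).differentiable (by norm_num)) _
  have hi : ∀ i, DifferentiableAt ℝ (u i) X := fun i =>
    ((hu i).contDiffAt (hΩ.mem_nhds hX)).differentiableAt (by norm_num)
  have ht : HasDerivAt (fun t : ℝ => tuple u (X + t • EuclideanSpace.single (Sum.inr j) (1 : ℝ)))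
      (WithLp.toLp 2 fun i => pd (u i) (Sum.inr j) X) 0 := by
    have h := hasDerivAt_pi.2 fun i =>
      (hi i).hasFDerivAt.hasLineDerivAt (EuclideanSpace.single (Sum.inr j) (1 : ℝ))
    exact (PiLp.hasFDerivAt_toLp 2 _).comp_hasDerivAt (0 : ℝ) h
  unfold HasLineDerivAt
  simp only [F1, xPart_add_smul_single_inr]
  have hcomp := HasFDerivAt.comp_hasDerivAt (l := pd (F (xPart X)) k) (0 : ℝ)
    (by simpa using hpd.hasFDerivAt) ht
  refine hcomp.congr_deriv ?_
  rw [fderiv_apply_eq_sum]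
  exact Finset.sum_congr rfl fun i _ => mul_comm _ _

theorem integral_eq_of_tsupport_subset {Ω : Set (E m d)} {f φ : E m d → ℝ}
    (hs : tsupport φ ⊆ Ω) (h : ∀ X, φ X = 0 → f X = 0) : ∫ X in Ω, f X = ∫ X, f X :=
  setIntegral_eq_integral_of_forall_compl_eq_zero fun X hX =>
    h X (image_eq_zero_of_notMem_tsupport fun hx => hX (hs hx))

theorem locallyIntegrableOn_sum_F2 {Ω : Set (E m d)}
    {a : Fin n → EuclideanSpace ℝ (Fin m) → ℝ → ℝ}
    {F : EuclideanSpace ℝ (Fin m) → EuclideanSpace ℝ (Fin n) → ℝ} {u : Fin n → E m d → ℝ}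
    (hΩ : IsOpen Ω) (hu : ∀ i, ContDiffOn ℝ 1 (u i) Ω) (hstab : IsStable Ω a F u)
    (k : Fin n) (j : Fin d) :
    LocallyIntegrableOn (fun X => ∑ i, F2 F u k i X * pd (u i) (Sum.inr j) X) Ω := by
  rw [locallyIntegrableOn_iff hΩ.isLocallyClosed]
  intro K hK hKc
  refine integrable_finsetSum _ fun i _ => ?_
  exact ((hstab.potential_integrable k i).integrableOn_compact_subset hK hKc).mul_continuousOn
    ((continuousOn_pd hΩ (hu i) _).mono hK) hKc

theorem BoundedMatrix.locallyIntegrableOn_mulVec {Ω : Set (E m d)}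
    {a : EuclideanSpace ℝ (Fin m) → ℝ → ℝ} {u : E m d → ℝ} (hA : BoundedMatrix Ω a u)
    (hu : IsRegular Ω u) (hΩ : IsOpen Ω) (b e : Fin m ⊕ Fin d) :
    LocallyIntegrableOn (fun X => ∑ c, coeffMatrix a (xPart X) (gradient u X) b c
      * pd (pd u e) c X) (noncriticalSet Ω u) := by
  have hGo := hu.isOpen_noncriticalSet hΩ
  rw [locallyIntegrableOn_iff hGo.isLocallyClosed]
  intro K hK hKc
  refine integrable_finsetSum _ fun c _ => ?_
  exact (hA.integrableOn hK hKc.isBounded b c).mul_continuousOn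
    ((continuousOn_pd hGo (hu.contDiffOn_pd_noncriticalSet hΩ e) c).mono hK) hKc

theorem formA_gradient_eq (a : EuclideanSpace ℝ (Fin m) → ℝ → ℝ) (u f φ : E m d → ℝ) (X : E m d) :
    formA a u X (gradient f X) (gradient φ X)
      = ∑ b, (∑ c, coeffMatrix a (xPart X) (gradient u X) b c * pd f c X) * pd φ b X := by
  simp only [formA_eq_sum, gradient_apply, Finset.sum_mul, mul_assoc]

/-- The weak equation is tested with φ_{y_j}; the y_j-derivative is then moved from φ onto the flux
and onto F_k. The flux can be differentiated only off the critical set, which is why φ is supported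
there. -/
theorem IsWeakSolution.linearized_of_isTest {Ω : Set (E m d)}
    {a : Fin n → EuclideanSpace ℝ (Fin m) → ℝ → ℝ}
    {F : EuclideanSpace ℝ (Fin m) → EuclideanSpace ℝ (Fin n) → ℝ} {u : Fin n → E m d → ℝ}
    (hsol : IsWeakSolution Ω a F u) (hΩ : IsOpen Ω) (ha : ∀ i, IsCoefficient (a i))
    (hF : ∀ x, ContDiff ℝ 2 (F x)) (hreg : ∀ i, IsRegular Ω (u i))
    (hA : ∀ i, BoundedMatrix Ω (a i) (u i)) (hstab : IsStable Ω a F u) (k : Fin n) (j : Fin d)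
    {φ : E m d → ℝ} (hφ : IsTest (noncriticalSet Ω (u k)) φ) :
    ∫ X, formA (a k) (u k) X (gradient (pd (u k) (Sum.inr j)) X) (gradient φ X)
      = ∫ X, (∑ i, F2 F u k i X * pd (u i) (Sum.inr j) X) * φ X := by
  have hGo := (hreg k).isOpen_noncriticalSet hΩ
  have hφΩ := hφ.mono (noncriticalSet_subset Ω (u k))
  have hflux : ∀ b, LocallyIntegrableOn
      (fun X => a k (xPart X) ‖gradient (u k) X‖ * pd (u k) b X) (noncriticalSet Ω (u k)) := by
    intro b
    rw [locallyIntegrableOn_iff hGo.isLocallyClosed]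
    intro K hK hKc
    have h := (EuclideanSpace.proj (𝕜 := ℝ) b : E m d →L[ℝ] ℝ).integrable_comp
      ((hsol.flux_integrable k).integrableOn_compact_subset
        (hK.trans (noncriticalSet_subset Ω (u k))) hKc)
    exact h.congr (ae_of_all _ fun X => by simp [gradient_apply])
  have hw := hsol.weak_eq (fun _ => pd φ (Sum.inr j)) (fun _ => hφΩ.pd _) k
  have hL : ∫ X in Ω, inner ℝ (a k (xPart X) ‖gradient (u k) X‖ • gradient (u k) X)
        (gradient (pd φ (Sum.inr j)) X)
      = - ∫ X, formA (a k) (u k) X (gradient (pd (u k) (Sum.inr j)) X) (gradient φ X) := by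
    have hpt : ∀ X, inner ℝ (a k (xPart X) ‖gradient (u k) X‖ • gradient (u k) X)
        (gradient (pd φ (Sum.inr j)) X)
        = ∑ b, (a k (xPart X) ‖gradient (u k) X‖ * pd (u k) b X)
            * pd (pd φ b) (Sum.inr j) X := by
      intro X
      rw [PiLp.inner_apply]
      refine Finset.sum_congr rfl fun b _ => ?_
      -- The order of the derivatives of φ is exchanged so that ∂_{y_j} is outermost: the flux is
      -- known to be differentiable along y_j only.
      rw [pd_pd_comm (hφ.1.contDiffAt.of_le ENat.LEInfty.out)]
      simp [gradient_apply, mul_comm]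
    simp_rw [hpt, formA_gradient_eq]
    have hpdφ := fun b => hφ.pd b
    rw [integral_finsetSum, integral_finsetSum, ← Finset.sum_neg_distrib]
    · refine Finset.sum_congr rfl fun b _ => ?_
      rw [integral_eq_of_tsupport_subset ((hφΩ.pd b).pd (Sum.inr j)).2.2
        (fun X hX => by rw [hX, mul_zero])]
      exact integral_mul_pd_eq_neg _ ((hpdφ b).1.of_le (by exact_mod_cast le_top)) (hpdφ b).2.1
        (hpdφ b).2.2 (hflux b) ((hA k).locallyIntegrableOn_mulVec (hreg k) hΩ b _)
        (fun X hX => (hreg k).hasLineDerivAt_flux (ha k) hΩ hX b j)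
    · exact fun b _ => LocallyIntegrableOn.integrable_mul_of_tsupport
        ((hA k).locallyIntegrableOn_mulVec (hreg k) hΩ b _) (hpdφ b).1.continuous.continuousOn
        (hpdφ b).2.1 (hpdφ b).2.2
    · exact fun b _ => (LocallyIntegrableOn.integrable_mul_of_tsupport (hflux b)
        ((hpdφ b).pd _).1.continuous.continuousOn ((hpdφ b).pd _).2.1
        ((hpdφ b).pd _).2.2).integrableOn
  have hR : ∫ X in Ω, F1 F u k X * pd φ (Sum.inr j) X
      = - ∫ X, (∑ i, F2 F u k i X * pd (u i) (Sum.inr j) X) * φ X := by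
    rw [integral_eq_of_tsupport_subset (hφΩ.pd (Sum.inr j)).2.2
      (fun X hX => by rw [hX, mul_zero])]
    exact integral_mul_pd_eq_neg _ (hφ.1.of_le (by exact_mod_cast le_top)) hφΩ.2.1 hφΩ.2.2
      (hsol.source_integrable k)
      (locallyIntegrableOn_sum_F2 hΩ (fun i => (hreg i).contDiffOn_one) hstab k j)
      (fun X hX => hasLineDerivAt_F1 hF hΩ (fun i => (hreg i).contDiffOn_one) hX k j)
  rw [hL, hR] at hw
  exact neg_injective hw

/-- The equation satisfied by `u^k_{y_j}`, tested with compactly supported `C^1` functions. -/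
theorem IsWeakSolution.linearized {Ω : Set (E m d)}
    {a : Fin n → EuclideanSpace ℝ (Fin m) → ℝ → ℝ}
    {F : EuclideanSpace ℝ (Fin m) → EuclideanSpace ℝ (Fin n) → ℝ} {u : Fin n → E m d → ℝ}
    (hsol : IsWeakSolution Ω a F u) (hΩ : IsOpen Ω) (ha : ∀ i, IsCoefficient (a i))
    (hF : ∀ x, ContDiff ℝ 2 (F x)) (hreg : ∀ i, IsRegular Ω (u i))
    (hA : ∀ i, BoundedMatrix Ω (a i) (u i)) (hstab : IsStable Ω a F u) (k : Fin n) (j : Fin d)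
    {φ : E m d → ℝ} (hφ : ContDiff ℝ 1 φ) (hc : HasCompactSupport φ)
    (hs : tsupport φ ⊆ noncriticalSet Ω (u k)) :
    ∫ X, formA (a k) (u k) X (gradient (pd (u k) (Sum.inr j)) X) (gradient φ X)
      = ∫ X, (∑ i, F2 F u k i X * pd (u i) (Sum.inr j) X) * φ X := by
  have hGo := (hreg k).isOpen_noncriticalSet hΩ
  obtain ⟨f, K, C, hK, hKG, hφK, hft, hfK, hfC, hfpC, hlim, hlimp⟩ :=
    exists_isTest_tendsto hGo hφ hc hs
  have hKΩ := hKG.trans (noncriticalSet_subset Ω (u k))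
  have hAint := fun b => ((hA k).locallyIntegrableOn_mulVec (hreg k) hΩ b
    (Sum.inr j)).integrableOn_compact_subset hKG hK
  have hFint := (locallyIntegrableOn_sum_F2 hΩ (fun i => (hreg i).contDiffOn_one) hstab k
    j).integrableOn_compact_subset hKΩ hK
  have hrestr : ∀ (g h : E m d → ℝ), tsupport g ⊆ K →
      ∫ X, h X * g X = ∫ X in K, h X * g X := fun g h hg =>
    (integral_eq_of_tsupport_subset hg fun X hX => by rw [hX, mul_zero]).symm
  have hrestr' : ∀ g : E m d → ℝ, tsupport g ⊆ K →
      ∫ X, formA (a k) (u k) X (gradient (pd (u k) (Sum.inr j)) X) (gradient g X)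
      = ∫ X in K, formA (a k) (u k) X (gradient (pd (u k) (Sum.inr j)) X) (gradient g X) := by
    intro g hg
    refine (setIntegral_eq_integral_of_forall_compl_eq_zero fun X hX => ?_).symm
    rw [formA_gradient_eq]
    refine Finset.sum_eq_zero fun b _ => ?_
    rw [image_eq_zero_of_notMem_tsupport (f := pd g b)
      (fun h => hX (hg (tsupport_pd_subset g b h))), mul_zero]
  have hR : Tendsto (fun l => ∫ X, (∑ i, F2 F u k i X * pd (u i) (Sum.inr j) X) * f l X) atTop
      (𝓝 (∫ X, (∑ i, F2 F u k i X * pd (u i) (Sum.inr j) X) * φ X)) := by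
    simp_rw [fun l => hrestr (f l) (fun X => ∑ i, F2 F u k i X * pd (u i) (Sum.inr j) X) (hfK l),
      hrestr φ (fun X => ∑ i, F2 F u k i X * pd (u i) (Sum.inr j) X) hφK]
    exact tendsto_integral_mul_of_bounded hFint
      (fun l => (hft l).1.continuous.aestronglyMeasurable)
      (fun l => ae_of_all _ (hfC l)) (ae_of_all _ hlim)
  have hpdc : ∀ g : E m d → ℝ, ContDiff ℝ 1 g → ∀ b, Continuous (pd g b) := fun g hg b =>
    (hg.continuous_fderiv (by norm_num)).clm_apply continuous_const
  have hsplit : ∀ g : E m d → ℝ, ContDiff ℝ 1 g → tsupport g ⊆ K →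
      ∫ X, formA (a k) (u k) X (gradient (pd (u k) (Sum.inr j)) X) (gradient g X)
      = ∑ b, ∫ X in K, (∑ c, coeffMatrix (a k) (xPart X) (gradient (u k) X) b c
          * pd (pd (u k) (Sum.inr j)) c X) * pd g b X := by
    intro g hg hgK
    rw [hrestr' g hgK]
    simp_rw [formA_gradient_eq]
    rw [integral_finsetSum]
    exact fun b _ => (hAint b).mul_continuousOn (hpdc g hg b).continuousOn hK
  have hL : Tendsto (fun l => ∫ X, formA (a k) (u k) X (gradient (pd (u k) (Sum.inr j)) X)
      (gradient (f l) X)) atTop (𝓝 (∫ X, formA (a k) (u k) X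
        (gradient (pd (u k) (Sum.inr j)) X) (gradient φ X))) := by
    have hf1 : ∀ l, ContDiff ℝ 1 (f l) := fun l => (hft l).1.of_le (by exact_mod_cast le_top)
    simp_rw [fun l => hsplit (f l) (hf1 l) (hfK l), hsplit φ hφ hφK]
    refine tendsto_finsetSum _ fun b _ => ?_
    exact tendsto_integral_mul_of_bounded (hAint b)
      (fun l => (hpdc (f l) (hf1 l) b).aestronglyMeasurable)
      (fun l => ae_of_all _ (hfpC l b)) (ae_of_all _ (hlimp b))
  refine tendsto_nhds_unique hL (hR.congr fun l => ?_)
  exact (hsol.linearized_of_isTest hΩ ha hF hreg hA hstab k j (hft l)).symm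

/-! ### Stability for `C^1` test functions -/

/-- Since all supports lie in one compact subset of the noncritical set, the matrix entries are
integrable there; expanding the form into entries leaves bounded, pointwise convergent products of
derivatives. -/
theorem tendsto_integral_formA_gradient {Ω K : Set (E m d)}
    {a : EuclideanSpace ℝ (Fin m) → ℝ → ℝ} {u : E m d → ℝ} (hA : BoundedMatrix Ω a u)
    (hK : IsCompact K) (hKG : K ⊆ noncriticalSet Ω u) {f : ℕ → E m d → ℝ} {φ : E m d → ℝ} {C : ℝ}
    (hf : ∀ l, ContDiff ℝ 1 (f l)) (hφ : ContDiff ℝ 1 φ) (hfK : ∀ l, tsupport (f l) ⊆ K)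
    (hφK : tsupport φ ⊆ K) (hC : ∀ l b X, |pd (f l) b X| ≤ C)
    (hlim : ∀ b X, Tendsto (fun l => pd (f l) b X) atTop (𝓝 (pd φ b X))) :
    Tendsto (fun l => ∫ X, formA a u X (gradient (f l) X) (gradient (f l) X)) atTop
      (𝓝 (∫ X, formA a u X (gradient φ X) (gradient φ X))) := by
  have hpdc : ∀ g : E m d → ℝ, ContDiff ℝ 1 g → ∀ b, Continuous (pd g b) := fun g hg b =>
    (hg.continuous_fderiv (by norm_num)).clm_apply continuous_const
  have hsplit : ∀ g : E m d → ℝ, ContDiff ℝ 1 g → tsupport g ⊆ K →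
      ∫ X, formA a u X (gradient g X) (gradient g X)
      = ∑ b, ∑ c, ∫ X in K, coeffMatrix a (xPart X) (gradient u X) b c
          * (pd g c X * pd g b X) := by
    intro g hg hgK
    rw [← setIntegral_eq_integral_of_forall_compl_eq_zero (s := K)]
    · simp_rw [formA_eq_sum, gradient_apply]
      have hfi : ∀ b c, IntegrableOn (fun X => coeffMatrix a (xPart X) (gradient u X) b c
          * (pd g c X * pd g b X)) K := fun b c => (hA.integrableOn hKG hK.isBounded b c).mul_continuousOn
        ((hpdc g hg c).mul (hpdc g hg b)).continuousOn hK
      rw [integral_finsetSum _ fun b _ => integrable_finsetSum _ fun c _ => hfi b c]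
      exact Finset.sum_congr rfl fun b _ => integral_finsetSum _ fun c _ => hfi b c
    · intro X hX
      rw [formA_eq_sum]
      refine Finset.sum_eq_zero fun b _ => Finset.sum_eq_zero fun c _ => ?_
      rw [gradient_apply, gradient_apply, image_eq_zero_of_notMem_tsupport (f := pd g b)
        (fun h => hX (hgK (tsupport_pd_subset g b h))), mul_zero, mul_zero]
  simp_rw [fun l => hsplit (f l) (hf l) (hfK l), hsplit φ hφ hφK]
  refine tendsto_finsetSum _ fun b _ => tendsto_finsetSum _ fun c _ => ?_
  refine tendsto_integral_mul_of_bounded (C := C * C) (hA.integrableOn hKG hK.isBounded b c)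
    (fun l => ((hpdc _ (hf l) c).mul (hpdc _ (hf l) b)).aestronglyMeasurable)
    (fun l => ae_of_all _ fun X => ?_)
    (ae_of_all _ fun X => (hlim c X).mul (hlim b X))
  rw [abs_mul]
  exact mul_le_mul (hC l c X) (hC l b X) (abs_nonneg _) ((abs_nonneg _).trans (hC l c X))

/-- Each component is mollified separately, inside the noncritical set of its own u^i. The form of
index i involves only the i-th component, so different components may have different admissible
sets. -/
theorem IsStable.nonneg_of_contDiff {Ω : Set (E m d)}
    {a : Fin n → EuclideanSpace ℝ (Fin m) → ℝ → ℝ}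
    {F : EuclideanSpace ℝ (Fin m) → EuclideanSpace ℝ (Fin n) → ℝ} {u : Fin n → E m d → ℝ}
    (hstab : IsStable Ω a F u) (hΩ : IsOpen Ω) (hreg : ∀ i, IsRegular Ω (u i))
    (hA : ∀ i, BoundedMatrix Ω (a i) (u i)) {v : Fin n → E m d → ℝ}
    (hv : ∀ i, ContDiff ℝ 1 (v i)) (hc : ∀ i, HasCompactSupport (v i))
    (hs : ∀ i, tsupport (v i) ⊆ noncriticalSet Ω (u i)) :
    0 ≤ (∑ i, ∫ X, formA (a i) (u i) X (gradient (v i) X) (gradient (v i) X))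
      - ∑ i, ∑ j, ∫ X, F2 F u i j X * v i X * v j X := by
  choose f K C hK hKG hvK hft hfK hfC hfpC hlim hlimp using fun i =>
    exists_isTest_tendsto ((hreg i).isOpen_noncriticalSet hΩ) (hv i) (hc i) (hs i)
  have hKΩ := fun i => (hKG i).trans (noncriticalSet_subset Ω (u i))
  have h1 : Tendsto (fun l => ∑ i, ∫ X, formA (a i) (u i) X (gradient (f i l) X)
      (gradient (f i l) X)) atTop
      (𝓝 (∑ i, ∫ X, formA (a i) (u i) X (gradient (v i) X) (gradient (v i) X))) :=
    tendsto_finsetSum _ fun i _ => tendsto_integral_formA_gradient (hA i) (hK i) (hKG i)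
      (fun l => (hft i l).1.of_le (by exact_mod_cast le_top)) (hv i) (hfK i) (hvK i) (hfpC i)
      (hlimp i)
  have hrestr : ∀ i j (g h : E m d → ℝ), tsupport g ⊆ K i →
      ∫ X, F2 F u i j X * g X * h X = ∫ X in K i, F2 F u i j X * (g X * h X) := by
    intro i j g h hg
    simp_rw [← mul_assoc]
    exact (integral_eq_of_tsupport_subset hg fun X hX => by rw [hX, mul_zero, zero_mul]).symm
  have h2 : Tendsto (fun l => ∑ i, ∑ j, ∫ X, F2 F u i j X * f i l X * f j l X) atTop
      (𝓝 (∑ i, ∑ j, ∫ X, F2 F u i j X * v i X * v j X)) := by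
    refine tendsto_finsetSum _ fun i _ => tendsto_finsetSum _ fun j _ => ?_
    simp_rw [fun l => hrestr i j (f i l) (f j l) (hfK i l), hrestr i j (v i) (v j) (hvK i)]
    refine tendsto_integral_mul_of_bounded (C := C i * C j)
      ((hstab.potential_integrable i j).integrableOn_compact_subset (hKΩ i) (hK i))
      (fun l => ((hft i l).1.continuous.mul (hft j l).1.continuous).aestronglyMeasurable)
      (fun l => ae_of_all _ fun X => ?_)
      (ae_of_all _ fun X => (hlim i X).mul (hlim j X))
    rw [abs_mul]
    exact mul_le_mul (hfC i l X) (hfC j l X) (abs_nonneg _) ((abs_nonneg _).trans (hfC i l X))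
  refine ge_of_tendsto' (h1.sub h2) fun l => ?_
  have hT : ∀ i, IsTest Ω (f i l) := fun i => (hft i l).mono (noncriticalSet_subset Ω (u i))
  have h3 := hstab.nonneg (fun i => f i l) hT
  have h4 : ∀ i, ∫ X in Ω, formA (a i) (u i) X (gradient (f i l) X) (gradient (f i l) X)
      = ∫ X, formA (a i) (u i) X (gradient (f i l) X) (gradient (f i l) X) := by
    intro i
    refine setIntegral_eq_integral_of_forall_compl_eq_zero fun X hX => ?_
    rw [formA_eq_sum]
    refine Finset.sum_eq_zero fun b _ => Finset.sum_eq_zero fun c _ => ?_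
    rw [gradient_apply, gradient_apply, image_eq_zero_of_notMem_tsupport (f := pd (f i l) b)
      (fun h => hX ((hT i).2.2 (tsupport_pd_subset _ b h))), mul_zero, mul_zero]
  have h5 : ∀ i j, ∫ X in Ω, F2 F u i j X * f i l X * f j l X
      = ∫ X, F2 F u i j X * f i l X * f j l X := fun i j =>
    integral_eq_of_tsupport_subset (hT i).2.2 fun X hX => by rw [hX, mul_zero, zero_mul]
  simpa only [h4, h5] using h3

/-! ### Cutoff near the set where `∇_y u` vanishes -/

/-- A smooth function that vanishes for `t ≤ 1 / (l + 1)` and equals `1` for `t ≥ 2 / (l + 1)`. -/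
def cutoff (l : ℕ) (t : ℝ) : ℝ := Real.smoothTransition ((l + 1) * t - 1)

theorem contDiff_cutoff (l : ℕ) : ContDiff ℝ 1 (cutoff l) :=
  (Real.smoothTransition.contDiff (n := 1)).comp ((contDiff_const.mul contDiff_id).sub contDiff_const)

theorem cutoff_nonneg (l : ℕ) (t : ℝ) : 0 ≤ cutoff l t := Real.smoothTransition.nonneg _

theorem cutoff_le_one (l : ℕ) (t : ℝ) : cutoff l t ≤ 1 := Real.smoothTransition.le_one _

theorem abs_cutoff_le_one (l : ℕ) (t : ℝ) : |cutoff l t| ≤ 1 := by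
  rw [abs_of_nonneg (cutoff_nonneg l t)]
  exact cutoff_le_one l t

theorem cutoff_eq_zero {l : ℕ} {t : ℝ} (h : t ≤ 1 / (l + 1)) : cutoff l t = 0 := by
  refine Real.smoothTransition.zero_of_nonpos ?_
  have hl : (0 : ℝ) < l + 1 := by positivity
  rw [le_div_iff₀ hl] at h
  linarith

theorem deriv_cutoff (l : ℕ) (t : ℝ) :
    deriv (cutoff l) t = (l + 1) * deriv Real.smoothTransition ((l + 1) * t - 1) := by
  have h1 : HasDerivAt (fun t : ℝ => ((l : ℝ) + 1) * t - 1) ((l + 1) * 1) t :=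
    ((hasDerivAt_id t).const_mul _).sub_const _
  have h2 : HasDerivAt Real.smoothTransition _ (((l : ℝ) + 1) * t - 1) :=
    ((Real.smoothTransition.contDiff (n := 1)).differentiable (by norm_num) _).hasDerivAt
  have h3 := (h2.comp t h1).deriv
  rw [mul_one, mul_comm] at h3
  exact h3

theorem deriv_smoothTransition_of_one_lt {s : ℝ} (h : 1 < s) :
    deriv Real.smoothTransition s = 0 := by
  have : Real.smoothTransition =ᶠ[𝓝 s] fun _ => 1 := by
    filter_upwards [Ioi_mem_nhds h] with r hr
    exact Real.smoothTransition.one_of_one_le (le_of_lt hr)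
  rw [this.deriv_eq, deriv_const]

theorem deriv_smoothTransition_of_neg {s : ℝ} (h : s < 0) :
    deriv Real.smoothTransition s = 0 := by
  have : Real.smoothTransition =ᶠ[𝓝 s] fun _ => 0 := by
    filter_upwards [Iio_mem_nhds h] with r hr
    exact Real.smoothTransition.zero_of_nonpos (le_of_lt hr)
  rw [this.deriv_eq, deriv_const]

/-- With s = (l+1)t - 1 the quantity t χ_l'(t) equals (s+1) times the derivative of the transition
function at s, which no longer depends on l and vanishes outside 0 ≤ s ≤ 1. -/
theorem exists_abs_mul_deriv_cutoff_le :
    ∃ C : ℝ, 0 ≤ C ∧ ∀ (l : ℕ) (t : ℝ), |t * deriv (cutoff l) t| ≤ C := by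
  have hcont : Continuous fun s : ℝ => (s + 1) * deriv Real.smoothTransition s :=
    (continuous_id.add continuous_const).mul
      ((Real.smoothTransition.contDiff (n := 1)).continuous_deriv (by norm_num))
  obtain ⟨C, hC⟩ := (isCompact_Icc (a := (0 : ℝ)) (b := 1)).exists_bound_of_continuousOn
    hcont.continuousOn
  have hC0 : 0 ≤ C := (norm_nonneg _).trans (hC 0 (by simp))
  refine ⟨C, hC0, fun l t => ?_⟩
  have h : t * deriv (cutoff l) t = (((l : ℝ) + 1) * t - 1 + 1)
      * deriv Real.smoothTransition (((l : ℝ) + 1) * t - 1) := by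
    rw [deriv_cutoff]; ring
  rw [h]
  rcases lt_or_ge (((l : ℝ) + 1) * t - 1) 0 with h0 | h0
  · rw [deriv_smoothTransition_of_neg h0]; simpa using hC0
  rcases lt_or_ge 1 (((l : ℝ) + 1) * t - 1) with h1 | h1
  · rw [deriv_smoothTransition_of_one_lt h1]; simpa using hC0
  · exact hC _ ⟨h0, h1⟩

theorem eventually_cutoff {t : ℝ} (ht : 0 < t) :
    ∀ᶠ l : ℕ in atTop, cutoff l t = 1 ∧ deriv (cutoff l) t = 0 := by
  obtain ⟨N, hN⟩ := exists_nat_gt (2 / t)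
  filter_upwards [eventually_ge_atTop N] with l hl
  have h1 : 1 < ((l : ℝ) + 1) * t - 1 := by
    have : (N : ℝ) ≤ l := by exact_mod_cast hl
    rw [div_lt_iff₀ ht] at hN
    nlinarith
  exact ⟨Real.smoothTransition.one_of_one_le h1.le,
    by rw [deriv_cutoff, deriv_smoothTransition_of_one_lt h1, mul_zero]⟩

theorem tendsto_cutoff {t : ℝ} (ht : 0 < t) :
    Tendsto (fun l => cutoff l t) atTop (𝓝 1) :=
  tendsto_const_nhds.congr' ((eventually_cutoff ht).mono fun _ h => h.1.symm)

theorem tendsto_deriv_cutoff {t : ℝ} (ht : 0 < t) :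
    Tendsto (fun l => deriv (cutoff l) t) atTop (𝓝 0) :=
  tendsto_const_nhds.congr' ((eventually_cutoff ht).mono fun _ h => h.2.symm)

/-- Unlike χ_l(t) itself, the product converges to its expected limit also at t = 0, so potential
terms can be treated on all of Ω. -/
theorem tendsto_mul_cutoff {t : ℝ} (ht : 0 ≤ t) :
    Tendsto (fun l => t * cutoff l t) atTop (𝓝 t) := by
  rcases ht.eq_or_lt with rfl | h
  · simp
  · simpa using (tendsto_cutoff h).const_mul t

/-- The support lies in the part of the support of ψ where |∇_y u| ≥ 1/(l+1), a compact subset of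
the regular set. Near it every factor is C¹, and off the support the product vanishes locally, so g
may be arbitrary outside the regular set. -/
theorem IsRegular.cutoff_mul {Ω : Set (E m d)} {u ψ g : E m d → ℝ} (hu : IsRegular Ω u)
    (hΩ : IsOpen Ω) (hψ : IsTest Ω ψ) (hg : ContDiffOn ℝ 1 g (regularSet Ω u)) (l : ℕ) :
    ContDiff ℝ 1 (fun X => cutoff l (normGradY u X) * (ψ X * g X)) ∧
      HasCompactSupport (fun X => cutoff l (normGradY u X) * (ψ X * g X)) ∧
      tsupport (fun X => cutoff l (normGradY u X) * (ψ X * g X)) ⊆ regularSet Ω u := by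
  have hRo := hu.isOpen_regularSet hΩ
  set φ := fun X => cutoff l (normGradY u X) * (ψ X * g X) with hφdef
  -- The function |∇_y u| is continuous on Ω only; closedness in the whole space comes from
  -- intersecting with the closed set `tsupport ψ`, which lies in Ω.
  have hclosed : IsClosed (tsupport ψ ∩ normGradY u ⁻¹' Ici (1 / ((l : ℝ) + 1))) :=
    ((hu.continuousOn_normGradY hΩ).mono hψ.2.2).preimage_isClosed_of_isClosed
      (isClosed_tsupport ψ) isClosed_Ici
  have hts : tsupport φ ⊆ tsupport ψ ∩ normGradY u ⁻¹' Ici (1 / ((l : ℝ) + 1)) := by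
    refine closure_minimal (fun X hX => ⟨?_, ?_⟩) hclosed
    · by_contra h
      exact hX (by simp [hφdef, image_eq_zero_of_notMem_tsupport h])
    · by_contra h
      exact hX (by simp [hφdef, cutoff_eq_zero (le_of_lt (not_le.1 h))])
  have hR : tsupport φ ⊆ regularSet Ω u := by
    intro X hX
    refine ⟨hψ.2.2 (hts hX).1, fun h0 => ?_⟩
    have h1 : 1 / ((l : ℝ) + 1) ≤ normGradY u X := (hts hX).2
    rw [normGradY, h0, norm_zero] at h1
    exact absurd h1 (not_le.2 (by positivity))
  refine ⟨contDiff_iff_contDiffAt.2 fun X => ?_,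
    hψ.2.1.of_isClosed_subset (isClosed_tsupport _) (hts.trans inter_subset_left), hR⟩
  by_cases hX : X ∈ tsupport φ
  · have hn := hRo.mem_nhds (hR hX)
    exact ((contDiff_cutoff l).contDiffAt.comp X ((hu.contDiffOn_normGradY hΩ).contDiffAt hn)).mul
      ((hψ.1.contDiffAt.of_le (by exact_mod_cast le_top)).mul (hg.contDiffAt hn))
  · exact contDiffAt_const.congr_of_eventuallyEq (notMem_tsupport_iff_eventuallyEq.1 hX)

theorem gradient_mul {f g : E m d → ℝ} {X : E m d} (hf : DifferentiableAt ℝ f X)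
    (hg : DifferentiableAt ℝ g X) :
    gradient (fun Y => f Y * g Y) X = f X • gradient g X + g X • gradient f X := by
  ext b
  have := (hf.hasFDerivAt.mul hg.hasFDerivAt).fderiv
  simp only [PiLp.add_apply, PiLp.smul_apply, smul_eq_mul, gradient_apply, pd]
  change fderiv ℝ (f * g) X _ = _
  rw [this]
  simp

theorem gradient_comp_deriv {h : ℝ → ℝ} {f : E m d → ℝ} {X : E m d}
    (hh : DifferentiableAt ℝ h (f X)) (hf : DifferentiableAt ℝ f X) :
    gradient (fun Y => h (f Y)) X = deriv h (f X) • gradient f X := by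
  ext b
  have := (hh.hasDerivAt.comp_hasFDerivAt X hf.hasFDerivAt).fderiv
  simp only [PiLp.smul_apply, smul_eq_mul, gradient_apply, pd]
  change fderiv ℝ (h ∘ f) X _ = _
  rw [this]
  simp

theorem IsRegular.gradient_cutoff_mul {Ω : Set (E m d)} {u ψ g : E m d → ℝ} (hu : IsRegular Ω u)
    (hΩ : IsOpen Ω) (hψ : IsTest Ω ψ) (hg : ContDiffOn ℝ 1 g (regularSet Ω u)) (l : ℕ)
    {X : E m d} (hX : X ∈ regularSet Ω u) :
    gradient (fun X => cutoff l (normGradY u X) * (ψ X * g X)) X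
      = cutoff l (normGradY u X) • (ψ X • gradient g X + g X • gradient ψ X)
        + (ψ X * g X * deriv (cutoff l) (normGradY u X)) • gradient (normGradY u) X := by
  have hn := (hu.isOpen_regularSet hΩ).mem_nhds hX
  have hw : DifferentiableAt ℝ (normGradY u) X :=
    ((hu.contDiffOn_normGradY hΩ).contDiffAt hn).differentiableAt (by norm_num)
  have hgd : DifferentiableAt ℝ g X := (hg.contDiffAt hn).differentiableAt (by norm_num)
  have hψd : DifferentiableAt ℝ ψ X := hψ.1.differentiable (by simp) X
  have hχ : DifferentiableAt ℝ (cutoff l) (normGradY u X) :=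
    (contDiff_cutoff l).differentiable (by norm_num) _
  rw [gradient_mul (f := fun X => cutoff l (normGradY u X)) (hχ.comp X hw) (hψd.fun_mul hgd),
    gradient_mul hψd hgd, gradient_comp_deriv hχ hw, smul_smul]

/-! ### Passing to the limit in the cutoff -/

section Component

variable {Ω : Set (E m d)} {a : EuclideanSpace ℝ (Fin m) → ℝ → ℝ} {u ψ : E m d → ℝ}

theorem IsRegular.integrableOn_formA_pd (hu : IsRegular Ω u) (hΩ : IsOpen Ω)
    (hA : BoundedMatrix Ω a u) (hψ : IsTest Ω ψ) (b : Fin m ⊕ Fin d) :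
    IntegrableOn (fun X => formA a u X (gradient (pd u b) X) (gradient (pd u b) X) * ψ X ^ 2)
      (regularSet Ω u) := by
  have hRm := (hu.isOpen_regularSet hΩ).measurableSet
  have hS : regularSet Ω u ∩ tsupport ψ ⊆ noncriticalSet Ω u :=
    inter_subset_left.trans (regularSet_subset_noncriticalSet Ω u)
  have hv : ∀ c, MemLp (fun X => gradient (pd u b) X c) 2
      (volume.restrict (regularSet Ω u ∩ tsupport ψ)) := fun c => by
    simp_rw [gradient_apply]
    exact hu.memLp_pd_pd hΩ hψ.2.1 hψ.2.2
      (hRm.inter (isClosed_tsupport ψ).measurableSet) hS inter_subset_right b c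
  exact IntegrableOn.mul_of_tsupport_subset hRm
    (hA.integrableOn_formA hS (hψ.2.1.isBounded.subset inter_subset_right) hv hv)
    (hψ.1.continuous.pow 2) (hψ.2.1.comp_left (g := fun t : ℝ => t ^ 2) (by simp))
    (closure_mono fun X hX h => hX (by simp [h]))

theorem IsRegular.integrableOn_formA_normGradY (hu : IsRegular Ω u) (hΩ : IsOpen Ω)
    (hA : BoundedMatrix Ω a u) (hψ : IsTest Ω ψ) :
    IntegrableOn (fun X => formA a u X (gradient (normGradY u) X) (gradient (normGradY u) X)
      * ψ X ^ 2) (regularSet Ω u) := by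
  have hRm := (hu.isOpen_regularSet hΩ).measurableSet
  have hS : regularSet Ω u ∩ tsupport ψ ⊆ noncriticalSet Ω u :=
    inter_subset_left.trans (regularSet_subset_noncriticalSet Ω u)
  have hv := hu.memLp_gradient_normGradY hΩ hψ.2.1 hψ.2.2
    (hRm.inter (isClosed_tsupport ψ).measurableSet) inter_subset_left inter_subset_right
  exact IntegrableOn.mul_of_tsupport_subset hRm
    (hA.integrableOn_formA hS (hψ.2.1.isBounded.subset inter_subset_right) hv hv)
    (hψ.1.continuous.pow 2) (hψ.2.1.comp_left (g := fun t : ℝ => t ^ 2) (by simp))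
    (closure_mono fun X hX h => hX (by simp [h]))

theorem IsRegular.integrableOn_formA_mixed (hu : IsRegular Ω u) (hΩ : IsOpen Ω)
    (hA : BoundedMatrix Ω a u) (hψ : IsTest Ω ψ) :
    IntegrableOn (fun X => formA a u X (gradient ψ X) (gradient (normGradY u) X) * ψ X)
      (regularSet Ω u) := by
  have hRm := (hu.isOpen_regularSet hΩ).measurableSet
  have hS : regularSet Ω u ∩ tsupport ψ ⊆ noncriticalSet Ω u :=
    inter_subset_left.trans (regularSet_subset_noncriticalSet Ω u)
  exact IntegrableOn.mul_of_tsupport_subset hRm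
    (hA.integrableOn_formA hS (hψ.2.1.isBounded.subset inter_subset_right)
      (memLp_gradient_of_contDiff (hψ.1.of_le (by exact_mod_cast le_top)) hψ.2.1)
      (hu.memLp_gradient_normGradY hΩ hψ.2.1 hψ.2.2
        (hRm.inter (isClosed_tsupport ψ).measurableSet) inter_subset_left inter_subset_right))
    hψ.1.continuous hψ.2.1 subset_rfl

theorem formA_gradient_eq_zero {g : E m d → ℝ} {X : E m d} (hX : X ∉ tsupport g) (v : E m d) :
    formA a u X v (gradient g X) = 0 := by
  have : gradient g X = 0 := by
    ext b
    rw [gradient_apply, image_eq_zero_of_notMem_tsupport (f := pd g b)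
      (fun h => hX (tsupport_pd_subset g b h))]
    rfl
  rw [this, formA, inner_zero_right]

theorem IsRegular.exists_normGradY_le (hu : IsRegular Ω u) :
    ∃ C : ℝ, 0 ≤ C ∧ ∀ X ∈ Ω, normGradY u X ≤ C := by
  obtain ⟨C, hC⟩ := hu.gradient_bounded
  exact ⟨max C 0, le_max_right _ _, fun X hX =>
    ((normGradY_le_norm_gradient u X).trans (hC X hX)).trans (le_max_left _ _)⟩

theorem IsRegular.aestronglyMeasurable_comp_normGradY (hu : IsRegular Ω u) (hΩ : IsOpen Ω)
    {g : ℝ → ℝ} (hg : Continuous g) {S : Set (E m d)} (hS : MeasurableSet S) (hSΩ : S ⊆ Ω) :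
    AEStronglyMeasurable (fun X => g (normGradY u X)) (volume.restrict S) :=
  (hg.comp_continuousOn ((hu.continuousOn_normGradY hΩ).mono hSΩ)).aestronglyMeasurable hS

theorem continuous_deriv_cutoff (l : ℕ) : Continuous (deriv (cutoff l)) :=
  (contDiff_cutoff l).continuous_deriv (by norm_num)

/-- The energy of the cut-off functions `ψ |∇_y u| χ_l(|∇_y u|)` converges to that of
`ψ |∇_y u|`. -/
theorem IsRegular.tendsto_integral_formA_cutoff (hu : IsRegular Ω u) (hΩ : IsOpen Ω)
    (hA : BoundedMatrix Ω a u) (hψ : IsTest Ω ψ)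
    (hfi : IntegrableOn (fun X => formA a u X (gradient ψ X) (gradient ψ X)) Ω) :
    Tendsto (fun l => ∫ X,
      formA a u X (gradient (fun Y => cutoff l (normGradY u Y) * (ψ Y * normGradY u Y)) X)
        (gradient (fun Y => cutoff l (normGradY u Y) * (ψ Y * normGradY u Y)) X)) atTop
      (𝓝 ((∫ X in regularSet Ω u, formA a u X (gradient ψ X) (gradient ψ X) * normGradY u X ^ 2)
        + 2 * (∫ X in regularSet Ω u,
            formA a u X (gradient ψ X) (gradient (normGradY u) X) * ψ X * normGradY u X)
        + ∫ X in regularSet Ω u,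
            formA a u X (gradient (normGradY u) X) (gradient (normGradY u) X) * ψ X ^ 2)) := by
  have hRm := (hu.isOpen_regularSet hΩ).measurableSet
  have hRΩ := regularSet_subset Ω u
  obtain ⟨M, hM0, hM⟩ := hu.exists_normGradY_le
  obtain ⟨C, hC0, hC⟩ := exists_abs_mul_deriv_cutoff_le
  have hw1 := hu.contDiffOn_normGradY hΩ
  have hi1 := hfi.mono_set hRΩ
  have hi2 := hu.integrableOn_formA_mixed hΩ hA hψ
  have hi3 := hu.integrableOn_formA_normGradY hΩ hA hψ
  -- With w = |∇_y u|, the gradient of χ_l(w) ψ w is α_l(w) ∇ψ + ψ β_l(w) ∇w, where β_l is the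
  -- derivative of α_l. Thus the energy has weights α_l², 2 α_l β_l and β_l², all bounded, with
  -- limits w², 2w and 1.
  let α : ℕ → ℝ → ℝ := fun l t => t * cutoff l t
  let β : ℕ → ℝ → ℝ := fun l t => cutoff l t + t * deriv (cutoff l) t
  have hαc : ∀ l, Continuous (α l) := fun l => continuous_id.mul (contDiff_cutoff l).continuous
  have hβc : ∀ l, Continuous (β l) := fun l =>
    (contDiff_cutoff l).continuous.add (continuous_id.mul (continuous_deriv_cutoff l))
  have hαb : ∀ l, ∀ X ∈ regularSet Ω u, |α l (normGradY u X)| ≤ M := fun l X hX => by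
    rw [abs_mul, abs_of_nonneg (normGradY_nonneg u X)]
    exact (mul_le_of_le_one_right (normGradY_nonneg u X) (abs_cutoff_le_one l _)).trans
      (hM X (hRΩ hX))
  have hβb : ∀ l t, |β l t| ≤ 1 + C := fun l t =>
    (abs_add_le _ _).trans (add_le_add (abs_cutoff_le_one l t) (hC l t))
  have hαt : ∀ X ∈ regularSet Ω u, Tendsto (fun l => α l (normGradY u X)) atTop
      (𝓝 (normGradY u X)) := fun X hX => tendsto_mul_cutoff (normGradY_nonneg u X)
  have hβt : ∀ X ∈ regularSet Ω u, Tendsto (fun l => β l (normGradY u X)) atTop (𝓝 1) := by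
    intro X hX
    simpa using (tendsto_cutoff (normGradY_pos hX)).add
      ((tendsto_deriv_cutoff (normGradY_pos hX)).const_mul (normGradY u X))
  have hm : ∀ g : ℝ → ℝ, Continuous g →
      AEStronglyMeasurable (fun X => g (normGradY u X)) (volume.restrict (regularSet Ω u)) :=
    fun g hg => hu.aestronglyMeasurable_comp_normGradY hΩ hg hRm hRΩ
  have hae : ∀ {p : E m d → Prop}, (∀ X ∈ regularSet Ω u, p X) →
      ∀ᵐ X ∂volume.restrict (regularSet Ω u), p X := fun h =>
    (ae_restrict_iff' hRm).2 (ae_of_all _ h)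
  have bnd : ∀ {x y A B : ℝ}, |x| ≤ A → |y| ≤ B → |x * y| ≤ A * B := fun hx hy => by
    rw [abs_mul]; exact mul_le_mul hx hy (abs_nonneg _) ((abs_nonneg _).trans hx)
  have t1 := tendsto_integral_mul_of_bounded hi1
    (g := fun l X => α l (normGradY u X) * α l (normGradY u X)) (C := M * M)
    (fun l => hm _ ((hαc l).mul (hαc l)))
    (fun l => hae fun X hX => bnd (hαb l X hX) (hαb l X hX))
    (hae fun X hX => (hαt X hX).mul (hαt X hX))
  have t2 := tendsto_integral_mul_of_bounded hi2
    (g := fun l X => α l (normGradY u X) * β l (normGradY u X)) (C := M * (1 + C))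
    (fun l => hm _ ((hαc l).mul (hβc l)))
    (fun l => hae fun X hX => bnd (hαb l X hX) (hβb l _))
    (hae fun X hX => (hαt X hX).mul (hβt X hX))
  have t3 := tendsto_integral_mul_of_bounded hi3
    (g := fun l X => β l (normGradY u X) * β l (normGradY u X)) (C := (1 + C) * (1 + C))
    (fun l => hm _ ((hβc l).mul (hβc l)))
    (fun l => hae fun X hX => bnd (hβb l _) (hβb l _))
    (hae fun X hX => (hβt X hX).mul (hβt X hX))
  have t := (t1.add (t2.const_mul 2)).add t3
  simp only [mul_one, ← sq, one_pow] at t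
  refine t.congr fun l => ?_
  obtain ⟨-, -, hsub⟩ := hu.cutoff_mul hΩ hψ hw1 l
  rw [← setIntegral_eq_integral_of_forall_compl_eq_zero (s := regularSet Ω u)
    (fun X hX => formA_gradient_eq_zero (fun h => hX (hsub h)) _)]
  have b1 : IntegrableOn (fun X => formA a u X (gradient ψ X) (gradient ψ X)
      * α l (normGradY u X) ^ 2) (regularSet Ω u) :=
    Integrable.mul_bdd (c := M * M) hi1 (hm _ ((hαc l).pow 2))
      (hae fun X hX => by rw [sq]; exact bnd (hαb l X hX) (hαb l X hX))
  have b2 : IntegrableOn (fun X => formA a u X (gradient ψ X) (gradient (normGradY u) X) * ψ X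
      * (α l (normGradY u X) * β l (normGradY u X))) (regularSet Ω u) :=
    Integrable.mul_bdd (c := M * (1 + C)) hi2 (hm _ ((hαc l).mul (hβc l)))
      (hae fun X hX => bnd (hαb l X hX) (hβb l _))
  have b3 : IntegrableOn (fun X => formA a u X (gradient (normGradY u) X)
      (gradient (normGradY u) X) * ψ X ^ 2 * β l (normGradY u X) ^ 2) (regularSet Ω u) :=
    Integrable.mul_bdd (c := (1 + C) * (1 + C)) hi3 (hm _ ((hβc l).pow 2))
      (hae fun X hX => by rw [sq]; exact bnd (hβb l _) (hβb l _))
  rw [← integral_const_mul, ← integral_add b1 (b2.const_mul 2),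
    ← integral_add (b1.fun_add (b2.const_mul 2)) b3]
  refine setIntegral_congr_fun hRm fun X hX => ?_
  rw [hu.gradient_cutoff_mul hΩ hψ hw1 l hX]
  simp only [formA_add_left, formA_add_right, formA_smul_left, formA_smul_right, α, β,
    formA_comm a u X (gradient (normGradY u) X) (gradient ψ X)]
  ring

/-- The linearized operator applied to `u_{y_j}` and tested with `ψ² u_{y_j} χ_l(|∇_y u|)`, summed
over `j`, in the limit `l → ∞`. -/
theorem IsRegular.tendsto_sum_integral_formA_cutoff (hu : IsRegular Ω u) (hΩ : IsOpen Ω)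
    (hA : BoundedMatrix Ω a u) (hψ : IsTest Ω ψ) :
    Tendsto (fun l => ∑ j : Fin d, ∫ X, formA a u X (gradient (pd u (Sum.inr j)) X)
      (gradient (fun Y => cutoff l (normGradY u Y) * (ψ Y * (ψ Y * pd u (Sum.inr j) Y))) X)) atTop
      (𝓝 ((∫ X in regularSet Ω u, (∑ j : Fin d, formA a u X (gradient (pd u (Sum.inr j)) X)
            (gradient (pd u (Sum.inr j)) X)) * ψ X ^ 2)
        + 2 * (∫ X in regularSet Ω u,
            formA a u X (gradient ψ X) (gradient (normGradY u) X) * ψ X * normGradY u X))) := by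
  have hRm := (hu.isOpen_regularSet hΩ).measurableSet
  have hRΩ := regularSet_subset Ω u
  obtain ⟨M, hM0, hM⟩ := hu.exists_normGradY_le
  obtain ⟨C, hC0, hC⟩ := exists_abs_mul_deriv_cutoff_le
  have hi2 := hu.integrableOn_formA_mixed hΩ hA hψ
  have hi3 := hu.integrableOn_formA_normGradY hΩ hA hψ
  have hi1 : IntegrableOn (fun X => (∑ j : Fin d, formA a u X (gradient (pd u (Sum.inr j)) X)
      (gradient (pd u (Sum.inr j)) X)) * ψ X ^ 2) (regularSet Ω u) := by
    simp_rw [Finset.sum_mul]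
    exact integrable_finsetSum _ fun j _ => hu.integrableOn_formA_pd hΩ hA hψ (Sum.inr j)
  have hg : ∀ j : Fin d, ContDiffOn ℝ 1 (fun Y => ψ Y * pd u (Sum.inr j) Y) (regularSet Ω u) :=
    fun j => (hψ.1.of_le (by exact_mod_cast le_top)).contDiffOn.mul
      ((hu.contDiffOn_pd_noncriticalSet hΩ _).mono (regularSet_subset_noncriticalSet Ω u))
  have hm : ∀ g : ℝ → ℝ, Continuous g →
      AEStronglyMeasurable (fun X => g (normGradY u X)) (volume.restrict (regularSet Ω u)) :=
    fun g hg => hu.aestronglyMeasurable_comp_normGradY hΩ hg hRm hRΩ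
  have hae : ∀ {p : E m d → Prop}, (∀ X ∈ regularSet Ω u, p X) →
      ∀ᵐ X ∂volume.restrict (regularSet Ω u), p X := fun h =>
    (ae_restrict_iff' hRm).2 (ae_of_all _ h)
  have hαc : ∀ l, Continuous fun t => t * cutoff l t := fun l =>
    continuous_id.mul (contDiff_cutoff l).continuous
  have hγc : ∀ l, Continuous fun t => t * deriv (cutoff l) t := fun l =>
    continuous_id.mul (continuous_deriv_cutoff l)
  have hαb : ∀ l, ∀ X ∈ regularSet Ω u, |normGradY u X * cutoff l (normGradY u X)| ≤ M :=
    fun l X hX => by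
      rw [abs_mul, abs_of_nonneg (normGradY_nonneg u X)]
      exact (mul_le_of_le_one_right (normGradY_nonneg u X) (abs_cutoff_le_one l _)).trans
        (hM X (hRΩ hX))
  have t1 := tendsto_integral_mul_of_bounded hi1
    (g := fun l X => cutoff l (normGradY u X)) (C := 1)
    (fun l => hm _ (contDiff_cutoff l).continuous)
    (fun l => hae fun X hX => abs_cutoff_le_one l _)
    (hae fun X hX => tendsto_cutoff (normGradY_pos hX))
  have t2 := tendsto_integral_mul_of_bounded hi2
    (g := fun l X => normGradY u X * cutoff l (normGradY u X)) (C := M)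
    (fun l => hm _ (hαc l)) (fun l => hae (hαb l))
    (hae fun X hX => tendsto_mul_cutoff (normGradY_nonneg u X))
  -- This is the error from differentiating the cutoff. Its weight w χ_l'(w) is uniformly bounded
  -- and tends to 0 pointwise on the regular set, so the error disappears in the limit.
  have t3 := tendsto_integral_mul_of_bounded hi3
    (g := fun l X => normGradY u X * deriv (cutoff l) (normGradY u X)) (C := C)
    (fun l => hm _ (hγc l)) (fun l => ae_of_all _ fun X => hC l _)
    (hae fun X hX => (tendsto_deriv_cutoff (normGradY_pos hX)).const_mul (normGradY u X))
  have t := (t1.add (t2.const_mul 2)).add t3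
  simp only [mul_one, mul_zero, integral_zero, add_zero] at t
  refine t.congr fun l => ?_
  have hcut := fun j => hu.cutoff_mul hΩ hψ (hg j) l
  have b1 := Integrable.mul_bdd (c := 1) hi1 (hm _ (contDiff_cutoff l).continuous)
    (hae fun X hX => abs_cutoff_le_one l _)
  have b2 := Integrable.mul_bdd (c := M) hi2 (hm _ (hαc l)) (hae (hαb l))
  have b3 := Integrable.mul_bdd (c := C) hi3 (hm _ (hγc l)) (ae_of_all _ fun X => hC l _)
  have hrestr : ∀ j : Fin d, ∫ X, formA a u X (gradient (pd u (Sum.inr j)) X)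
      (gradient (fun Y => cutoff l (normGradY u Y) * (ψ Y * (ψ Y * pd u (Sum.inr j) Y))) X)
      = ∫ X in regularSet Ω u, formA a u X (gradient (pd u (Sum.inr j)) X)
      (gradient (fun Y => cutoff l (normGradY u Y) * (ψ Y * (ψ Y * pd u (Sum.inr j) Y))) X) :=
    fun j => (setIntegral_eq_integral_of_forall_compl_eq_zero
      (fun X hX => formA_gradient_eq_zero (fun h => hX ((hcut j).2.2 h)) _)).symm
  have hintj : ∀ j : Fin d, IntegrableOn (fun X => formA a u X (gradient (pd u (Sum.inr j)) X)
      (gradient (fun Y => cutoff l (normGradY u Y) * (ψ Y * (ψ Y * pd u (Sum.inr j) Y))) X))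
      (regularSet Ω u) := by
    intro j
    obtain ⟨h1, h2, h3⟩ := hcut j
    have hTG := h3.trans (regularSet_subset_noncriticalSet Ω u)
    have h := hA.integrableOn_formA hTG h2.isBounded
      (v := gradient (pd u (Sum.inr j)))
      (fun c => by
        simp_rw [gradient_apply]
        exact hu.memLp_pd_pd hΩ h2 (h3.trans hRΩ) (isClosed_tsupport _).measurableSet hTG
          subset_rfl (Sum.inr j) c)
      (memLp_gradient_of_contDiff h1 h2)
    exact h.of_forall_sdiff_eq_zero hRm fun X hX => formA_gradient_eq_zero hX.2 _
  simp_rw [hrestr]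
  rw [← integral_finsetSum _ fun j _ => hintj j, ← integral_const_mul,
    ← integral_add b1 (b2.const_mul 2), ← integral_add (b1.fun_add (b2.const_mul 2)) b3]
  refine setIntegral_congr_fun hRm fun X hX => ?_
  have hpdd : ∀ j : Fin d, DifferentiableAt ℝ (pd u (Sum.inr j)) X := fun j =>
    ((hu.contDiffOn_pd_noncriticalSet hΩ (Sum.inr j)).contDiffAt
      ((hu.isOpen_noncriticalSet hΩ).mem_nhds
        (regularSet_subset_noncriticalSet Ω u hX))).differentiableAt (by norm_num)
  have hψd : DifferentiableAt ℝ ψ X := hψ.1.differentiable (by simp) X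
  -- Summation over j collapses the terms in which u_{y_j} multiplies ∇u_{y_j} into w ∇w. Taking z =
  -- ∇ψ produces the mixed term of the stability inequality, and z = ∇w the cutoff error.
  have key : ∀ z : E m d, ∑ j : Fin d, pd u (Sum.inr j) X
      * formA a u X (gradient (pd u (Sum.inr j)) X) z
      = normGradY u X * formA a u X (gradient (normGradY u) X) z := by
    intro z
    rw [← formA_smul_left, hu.normGradY_smul_gradient hΩ hX, formA_sum_left]
    exact Finset.sum_congr rfl fun j _ => (formA_smul_left _ _ _ _ _ _).symm
  have hterm : ∀ j : Fin d, formA a u X (gradient (pd u (Sum.inr j)) X)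
      (gradient (fun Y => cutoff l (normGradY u Y) * (ψ Y * (ψ Y * pd u (Sum.inr j) Y))) X)
      = ψ X ^ 2 * cutoff l (normGradY u X) * formA a u X (gradient (pd u (Sum.inr j)) X)
          (gradient (pd u (Sum.inr j)) X)
        + 2 * ψ X * cutoff l (normGradY u X)
          * (pd u (Sum.inr j) X * formA a u X (gradient (pd u (Sum.inr j)) X) (gradient ψ X))
        + ψ X ^ 2 * deriv (cutoff l) (normGradY u X) * (pd u (Sum.inr j) X
          * formA a u X (gradient (pd u (Sum.inr j)) X) (gradient (normGradY u) X)) := by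
    intro j
    rw [hu.gradient_cutoff_mul hΩ hψ (hg j) l hX, gradient_mul hψd (hpdd j)]
    simp only [formA_add_right, formA_smul_right]
    ring
  simp only [hterm, Finset.sum_add_distrib, ← Finset.mul_sum, key]
  rw [formA_comm a u X (gradient (normGradY u) X) (gradient ψ X)]
  ring

end Component

/-! ### The geometry of the level sets -/

/-- A symmetric operator is diagonalizable over ℝ, so the roots are its eigenvalues with
multiplicity, and the sum becomes a Hilbert–Schmidt norm computed in an eigenbasis. -/
theorem sum_sq_roots_charpoly {V : Type*} [NormedAddCommGroup V] [InnerProductSpace ℝ V]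
    [FiniteDimensional ℝ V] {S : V →ₗ[ℝ] V} (hS : S.IsSymmetric) :
    (S.charpoly.roots.map fun k => k ^ 2).sum
      = ∑ i, ‖S (hS.eigenvectorBasis rfl i)‖ ^ 2 := by
  rw [hS.roots_charpoly_eq_eigenvalues rfl, Multiset.map_map]
  change ∑ i, _ = _
  refine Finset.sum_congr rfl fun i _ => ?_
  rw [hS.apply_eigenvectorBasis, norm_smul, (hS.eigenvectorBasis rfl).orthonormal.1 i]
  simp

section

variable {V : Type*} [NormedAddCommGroup V] [InnerProductSpace ℝ V]

theorem coe_orthogonalProjectionOnto_orthogonal_singleton {ν : V} (hν : ‖ν‖ = 1) (x : V) :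
    (((Submodule.span ℝ {ν})ᗮ.orthogonalProjectionOnto x : (Submodule.span ℝ {ν})ᗮ) : V)
      = x - inner ℝ x ν • ν := by
  rw [Submodule.coe_orthogonalProjectionOnto_apply, Submodule.starProjection_orthogonal]
  simp [Submodule.starProjection_unit_singleton ℝ hν, real_inner_comm]

theorem norm_sq_eq_projection_add {ν : V} (hν : ‖ν‖ = 1) (x : V) :
    ‖x‖ ^ 2 = ‖(Submodule.span ℝ {ν})ᗮ.orthogonalProjectionOnto x‖ ^ 2 + inner ℝ x ν ^ 2 := by
  rw [Submodule.coe_norm, coe_orthogonalProjectionOnto_orthogonal_singleton hν,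
    norm_sub_sq_real, inner_smul_right, norm_smul, hν]
  simp only [Real.norm_eq_abs, mul_one, sq_abs]
  ring

/-- The Hilbert–Schmidt norm of a symmetric operator `T`, decomposed along a unit vector `ν` and its
orthogonal complement. -/
theorem sum_norm_sq_apply_eq {ι κ : Type*} [Fintype ι] [Fintype κ] [FiniteDimensional ℝ V]
    {T : V →ₗ[ℝ] V} (hT : T.IsSymmetric) {ν : V} (hν : ‖ν‖ = 1) (e : OrthonormalBasis ι ℝ V)
    (b : OrthonormalBasis κ ℝ (Submodule.span ℝ {ν})ᗮ) :
    ∑ i, ‖T (e i)‖ ^ 2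
      = ∑ k, ‖(Submodule.span ℝ {ν})ᗮ.orthogonalProjectionOnto (T (b k))‖ ^ 2
        + ‖(Submodule.span ℝ {ν})ᗮ.orthogonalProjectionOnto (T ν)‖ ^ 2 + ‖T ν‖ ^ 2 := by
  have h1 : ∀ x : V, ‖(Submodule.span ℝ {ν})ᗮ.orthogonalProjectionOnto x‖ ^ 2
      = ∑ k, inner ℝ x (b k : V) ^ 2 := by
    intro x
    rw [← b.sum_sq_norm_inner_left]
    refine Finset.sum_congr rfl fun k _ => ?_
    rw [Submodule.coe_inner, Submodule.coe_orthogonalProjectionOnto_apply,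
      Submodule.inner_starProjection_left_eq_right, Submodule.starProjection_mem_subspace_eq_self,
      Real.norm_eq_abs, sq_abs]
  have h2 : ∀ x : V, ∑ i, inner ℝ (T (e i)) x ^ 2 = ‖T x‖ ^ 2 := by
    intro x
    rw [← e.sum_sq_norm_inner_right]
    refine Finset.sum_congr rfl fun i _ => ?_
    rw [hT, Real.norm_eq_abs, sq_abs]
  -- Each T e_i is expanded along the b_k and ν. Interchanging the sums and moving T across the
  -- inner product turns Parseval in the basis e into the norms of T b_k and T ν.
  have h3 : ∑ i, ‖T (e i)‖ ^ 2 = ∑ k, ‖T (b k)‖ ^ 2 + ‖T ν‖ ^ 2 := by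
    simp_rw [norm_sq_eq_projection_add hν (T (e _)), h1, Finset.sum_add_distrib, h2]
    rw [Finset.sum_comm]
    simp_rw [h2]
  rw [h3]
  simp_rw [norm_sq_eq_projection_add hν (T (b _)), Finset.sum_add_distrib]
  -- The normal components ⟨T b_k, ν⟩ = ⟨T ν, b_k⟩ are the tangential coordinates of T ν, so the
  -- off-diagonal block appears once as the projection of T ν and once more inside ‖T ν‖².
  rw [h1 (T ν)]
  congr 2
  refine Finset.sum_congr rfl fun k _ => ?_
  rw [hT, real_inner_comm]

end

theorem join_xPart_yPart (X : E m d) : join (xPart X) (yPart X) = X := by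
  ext b
  cases b <;> rfl

/-- The Hessian of `u` in the variable `y`, as a linear map. -/
def hessY (u : E m d → ℝ) (X : E m d) : EuclideanSpace ℝ (Fin d) →ₗ[ℝ] EuclideanSpace ℝ (Fin d) :=
  Matrix.toEuclideanLin (Matrix.of fun i j => pd (pd u (Sum.inr i)) (Sum.inr j) X)

theorem hessY_apply (u : E m d → ℝ) (X : E m d) (v : EuclideanSpace ℝ (Fin d)) (i : Fin d) :
    hessY u X v i = ∑ j, pd (pd u (Sum.inr i)) (Sum.inr j) X * v j := by
  simp [hessY, Matrix.toLpLin_apply, Matrix.mulVec, dotProduct]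

theorem hessY_isSymmetric {u : E m d → ℝ} {X : E m d} (hu : ContDiffAt ℝ 2 u X) :
    (hessY u X).IsSymmetric := by
  intro v w
  simp only [PiLp.inner_apply, hessY_apply, RCLike.inner_apply, conj_trivial, Finset.mul_sum,
    Finset.sum_mul]
  rw [Finset.sum_comm]
  refine Finset.sum_congr rfl fun i _ => Finset.sum_congr rfl fun j _ => ?_
  rw [pd_pd_comm hu]
  ring

/-- The inclusion `y ↦ (0, y)`. -/
def inclY : EuclideanSpace ℝ (Fin d) →ₗ[ℝ] E m d where
  toFun v := join 0 v
  map_add' v w := by ext b; cases b <;> simp [join]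
  map_smul' c v := by ext b; cases b <;> simp [join]

theorem hasFDerivAt_join (x : EuclideanSpace ℝ (Fin m)) (y : EuclideanSpace ℝ (Fin d)) :
    HasFDerivAt (join x) (LinearMap.toContinuousLinearMap (inclY (m := m))) y := by
  have h : join x = fun v : EuclideanSpace ℝ (Fin d) => join x 0
      + LinearMap.toContinuousLinearMap (inclY (m := m)) v := by
    funext v
    ext b
    cases b <;> simp [join, inclY]
  rw [h]
  exact (ContinuousLinearMap.hasFDerivAt _).const_add _

theorem hasFDerivAt_gradY_join {u : E m d → ℝ} {X : E m d} (hu : ContDiffAt ℝ 2 u X) :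
    HasFDerivAt (fun y => gradY u (join (xPart X) y))
      (LinearMap.toContinuousLinearMap (hessY u X)) (yPart X) := by
  rw [← hasFDerivWithinAt_univ, hasFDerivWithinAt_euclidean]
  intro i
  rw [hasFDerivWithinAt_univ]
  have hd : DifferentiableAt ℝ (pd u (Sum.inr i)) (join (xPart X) (yPart X)) := by
    rw [join_xPart_yPart]
    exact ((hu.fderiv_right (m := 1) (by norm_num)).clm_apply contDiffAt_const).differentiableAt
      (by norm_num)
  have h := hd.hasFDerivAt.comp (yPart X) (hasFDerivAt_join (xPart X) (yPart X))
  refine h.congr_fderiv ?_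
  ext v
  rw [join_xPart_yPart]
  simp only [ContinuousLinearMap.comp_apply, LinearMap.coe_toContinuousLinearMap',
    fderiv_apply_eq_sum, Fintype.sum_sum_type, inclY]
  simp [join, mul_comm, hessY_apply]

/-- By the product rule, the derivative of ∇_y u / |∇_y u| is the Hessian divided by |∇_y u| plus a
multiple of ∇_y u, and the tangential projection kills the latter. -/
theorem shapeOperator_apply {u : E m d → ℝ} {X : E m d} (hu : ContDiffAt ℝ 2 u X)
    (hX : gradY u X ≠ 0) (v : tangentSpace u X) :
    shapeOperator u X v
      = -(‖gradY u X‖⁻¹ • (tangentSpace u X).orthogonalProjectionOnto (hessY u X v)) := by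
  have hg := hasFDerivAt_gradY_join hu
  have hX' : gradY u (join (xPart X) (yPart X)) ≠ 0 := by rwa [join_xPart_yPart]
  have hn : DifferentiableAt ℝ (fun y => ‖gradY u (join (xPart X) y)‖⁻¹) (yPart X) :=
    (hg.differentiableAt.norm ℝ hX').inv (norm_ne_zero_iff.2 hX')
  have h := (hn.hasFDerivAt.smul hg).fderiv
  have hperp : (tangentSpace u X).orthogonalProjectionOnto (gradY u X) = 0 :=
    Submodule.orthogonalProjectionOnto_eq_zero_iff.2
      (Submodule.le_orthogonal_orthogonal _ (Submodule.mem_span_singleton_self _))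
  have h' : fderiv ℝ (unitNormal u (xPart X)) (yPart X) (v : EuclideanSpace ℝ (Fin d))
      = ‖gradY u X‖⁻¹ • hessY u X v
        + fderiv ℝ (fun y => ‖gradY u (join (xPart X) y)‖⁻¹) (yPart X) v • gradY u X := by
    change fderiv ℝ ((fun y => ‖gradY u (join (xPart X) y)‖⁻¹) •
      fun y => gradY u (join (xPart X) y)) (yPart X) v = _
    rw [h]
    simp [join_xPart_yPart]
  simp only [shapeOperator, LinearMap.comp_apply, LinearMap.neg_apply, Submodule.subtype_apply,
    ContinuousLinearMap.coe_coe]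
  rw [h', map_neg, map_add, map_smul, map_smul, hperp, smul_zero, add_zero]

/-- The y-components of |∇_y u| ∇|∇_y u| = ∑_j u_{y_j} ∇u_{y_j}, with the Hessian read as a
symmetric matrix: it sends the unit normal to ∇_y|∇_y u|. -/
theorem IsRegular.gradY_normGradY {Ω : Set (E m d)} {u : E m d → ℝ} (hu : IsRegular Ω u)
    (hΩ : IsOpen Ω) {X : E m d} (hX : X ∈ regularSet Ω u) :
    gradY (normGradY u) X = hessY u X (‖gradY u X‖⁻¹ • gradY u X) := by
  have hC2 : ContDiffAt ℝ 2 u X := hu.contDiffOn_two.contDiffAt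
    ((hu.isOpen_noncriticalSet hΩ).mem_nhds (regularSet_subset_noncriticalSet Ω u hX))
  have hpos := normGradY_pos hX
  ext i
  have h := congrArg (fun v : E m d => v (Sum.inr i)) (hu.normGradY_smul_gradient hΩ hX)
  simp only [WithLp.ofLp_sum, Finset.sum_apply, PiLp.smul_apply, smul_eq_mul,
    gradient_apply] at h
  rw [gradY_apply, map_smul, PiLp.smul_apply, smul_eq_mul, hessY_apply]
  change _ = (normGradY u X)⁻¹ * _
  rw [eq_inv_mul_iff_mul_eq₀ hpos.ne', h]
  refine Finset.sum_congr rfl fun j _ => ?_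
  rw [pd_pd_comm hC2, gradY_apply, mul_comm]

/-- The identity of Sternberg and Zumbrun for the level sets of `u(x, ·)`. -/
theorem IsRegular.quantK_sq_mul {Ω : Set (E m d)} {u : E m d → ℝ} (hu : IsRegular Ω u)
    (hΩ : IsOpen Ω) {X : E m d} (hX : X ∈ regularSet Ω u) :
    quantK u X ^ 2 * ‖gradY u X‖ ^ 2 + ‖tangentialGrad u (normGradY u) X‖ ^ 2
      = (∑ i : Fin d, ∑ j : Fin d, pd (pd u (Sum.inr j)) (Sum.inr i) X ^ 2)
        - ‖gradY (normGradY u) X‖ ^ 2 := by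
  have hC2 : ContDiffAt ℝ 2 u X := hu.contDiffOn_two.contDiffAt
    ((hu.isOpen_noncriticalSet hΩ).mem_nhds (regularSet_subset_noncriticalSet Ω u hX))
  have hT := hessY_isSymmetric hC2
  have hg0 : ‖gradY u X‖ ≠ 0 := norm_ne_zero_iff.2 hX.2
  set ν := ‖gradY u X‖⁻¹ • gradY u X with hνdef
  have hν : ‖ν‖ = 1 := norm_smul_inv_norm hX.2
  have hW : tangentSpace u X = (Submodule.span ℝ {ν})ᗮ := by
    rw [tangentSpace, hνdef,
      Submodule.span_singleton_smul_eq (IsUnit.mk0 _ (inv_ne_zero hg0))]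
  have hsh := shapeOperator_apply hC2 hX.2
  have hSsymm : (shapeOperator u X).IsSymmetric := by
    intro v w
    rw [hsh, hsh]
    simp only [Submodule.coe_inner, Submodule.coe_smul,
      Submodule.coe_orthogonalProjectionOnto_apply, inner_neg_left, inner_neg_right,
      real_inner_smul_left, real_inner_smul_right]
    rw [Submodule.inner_starProjection_left_eq_right, ← Submodule.inner_starProjection_left_eq_right
      (tangentSpace u X) (v : EuclideanSpace ℝ (Fin d)), Submodule.starProjection_mem_subspace_eq_self,
      Submodule.starProjection_mem_subspace_eq_self, hT]
  have hK : quantK u X ^ 2 * ‖gradY u X‖ ^ 2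
      = ∑ k, ‖(tangentSpace u X).orthogonalProjectionOnto
          (hessY u X (hSsymm.eigenvectorBasis rfl k))‖ ^ 2 := by
    rw [quantK, principalCurvatures, Real.sq_sqrt, sum_sq_roots_charpoly hSsymm, Finset.sum_mul]
    · refine Finset.sum_congr rfl fun k _ => ?_
      rw [hsh, norm_neg, norm_smul, norm_inv, norm_norm]
      field_simp
    · rw [sum_sq_roots_charpoly hSsymm]
      exact Finset.sum_nonneg fun k _ => sq_nonneg _
  have htan : ‖tangentialGrad u (normGradY u) X‖
      = ‖(tangentSpace u X).orthogonalProjectionOnto (hessY u X ν)‖ := by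
    rw [Submodule.coe_norm, hW, coe_orthogonalProjectionOnto_orthogonal_singleton hν,
      tangentialGrad, unitNormal, join_xPart_yPart, ← hνdef, hu.gradY_normGradY hΩ hX]
  have hHS : ∑ i : Fin d, ∑ j : Fin d, pd (pd u (Sum.inr j)) (Sum.inr i) X ^ 2
      = ∑ i, ‖hessY u X (EuclideanSpace.basisFun (Fin d) ℝ i)‖ ^ 2 := by
    refine Finset.sum_congr rfl fun i _ => ?_
    rw [EuclideanSpace.norm_sq_eq]
    refine Finset.sum_congr rfl fun j _ => ?_
    rw [hessY_apply]
    simp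
  -- The eigenbasis is typed over `tangentSpace u X`, which equals the complement of ν only
  -- propositionally; stating the decomposition for a variable W lets the equality be substituted
  -- away.
  have hmain : ∀ (W : Submodule ℝ (EuclideanSpace ℝ (Fin d))) (_ : W = (Submodule.span ℝ {ν})ᗮ)
      (κ : Type) (_ : Fintype κ) (b : OrthonormalBasis κ ℝ W),
      ∑ i, ‖hessY u X (EuclideanSpace.basisFun (Fin d) ℝ i)‖ ^ 2
        = ∑ k, ‖W.orthogonalProjectionOnto (hessY u X (b k))‖ ^ 2
        + ‖W.orthogonalProjectionOnto (hessY u X ν)‖ ^ 2 + ‖hessY u X ν‖ ^ 2 := by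
    rintro W rfl κ _ b
    exact sum_norm_sq_apply_eq hT hν _ b
  rw [hK, htan, hHS, hu.gradY_normGradY hΩ hX, ← hνdef,
    hmain _ hW _ _ (hSsymm.eigenvectorBasis rfl)]
  ring

theorem norm_gradient_sq_eq (f : E m d → ℝ) (X : E m d) :
    ‖gradient f X‖ ^ 2 = ‖gradX f X‖ ^ 2 + ‖gradY f X‖ ^ 2 := by
  simp [EuclideanSpace.norm_sq_eq, Fintype.sum_sum_type, gradient_apply, gradX, gradY]

/-- The identity part of 𝒜 contributes ∑_j |∇u_{y_j}|² - |∇|∇_y u||²: its x-derivatives form 𝒮_u and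
its y-derivatives are the curvature identity. The rank-one part contributes 𝒯_u. -/
theorem IsRegular.geometricTerm_eq_formTerm {Ω : Set (E m d)}
    {a : EuclideanSpace ℝ (Fin m) → ℝ → ℝ} {u : E m d → ℝ} (hu : IsRegular Ω u)
    (hΩ : IsOpen Ω) {X : E m d} (hX : X ∈ regularSet Ω u) :
    geometricTerm a u X = formTerm a u X := by
  have hsum : ∑ j : Fin d, ‖gradient (pd u (Sum.inr j)) X‖ ^ 2
      = (∑ i : Fin m, ∑ j : Fin d, pd (pd u (Sum.inr j)) (Sum.inl i) X ^ 2)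
        + ∑ i : Fin d, ∑ j : Fin d, pd (pd u (Sum.inr j)) (Sum.inr i) X ^ 2 := by
    simp only [EuclideanSpace.norm_sq_eq, Fintype.sum_sum_type, gradient_apply,
      Finset.sum_add_distrib, Real.norm_eq_abs, sq_abs]
    congr 1 <;> exact Finset.sum_comm
  have hid : quantS u X + quantK u X ^ 2 * ‖gradY u X‖ ^ 2
        + ‖tangentialGrad u (normGradY u) X‖ ^ 2
      = ∑ j : Fin d, ‖gradient (pd u (Sum.inr j)) X‖ ^ 2 - ‖gradient (normGradY u) X‖ ^ 2 := by
    rw [add_assoc, hu.quantK_sq_mul hΩ hX, hsum, norm_gradient_sq_eq, quantS]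
    ring
  rw [geometricTerm, formTerm, hid, quantT]
  simp only [formA_eq, real_inner_self_eq_norm_sq, Finset.sum_add_distrib, ← Finset.mul_sum, ← sq]
  ring

/-! ### The inequality -/

section System

variable {Ω : Set (E m d)} {a : Fin n → EuclideanSpace ℝ (Fin m) → ℝ → ℝ}
  {F : EuclideanSpace ℝ (Fin m) → EuclideanSpace ℝ (Fin n) → ℝ} {u ψ : Fin n → E m d → ℝ}

theorem IsRegular.integrableOn_formTerm {a : EuclideanSpace ℝ (Fin m) → ℝ → ℝ} {u ψ : E m d → ℝ}
    (hu : IsRegular Ω u) (hΩ : IsOpen Ω) (hA : BoundedMatrix Ω a u) (hψ : IsTest Ω ψ) :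
    IntegrableOn (fun X => (∑ j : Fin d, formA a u X (gradient (pd u (Sum.inr j)) X)
        (gradient (pd u (Sum.inr j)) X)) * ψ X ^ 2) (regularSet Ω u) ∧
      IntegrableOn (fun X => formTerm a u X * ψ X ^ 2) (regularSet Ω u) := by
  have h : IntegrableOn (fun X => (∑ j : Fin d, formA a u X (gradient (pd u (Sum.inr j)) X)
        (gradient (pd u (Sum.inr j)) X)) * ψ X ^ 2) (regularSet Ω u) := by
    simp_rw [Finset.sum_mul]
    exact integrable_finsetSum _ fun j _ => hu.integrableOn_formA_pd hΩ hA hψ (Sum.inr j)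
  refine ⟨h, ?_⟩
  simp_rw [formTerm, sub_mul]
  exact h.sub (hu.integrableOn_formA_normGradY hΩ hA hψ)

theorem IsStable.integrableOn_potential_mul (hstab : IsStable Ω a F u) {φ g : E m d → ℝ}
    (hφ : IsTest Ω φ) (hg : ContinuousOn g Ω) (i j : Fin n) :
    IntegrableOn (fun X => F2 F u i j X * (φ X * g X)) Ω :=
  (LocallyIntegrableOn.integrable_mul_of_tsupport (hstab.potential_integrable i j)
    (hφ.1.continuous.continuousOn.mul hg) (hφ.2.1.mul_right)
    ((tsupport_mul_subset_left).trans hφ.2.2)).integrableOn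

theorem IsStable.integrableOn_energyTerm (hstab : IsStable Ω a F u) (hΩ : IsOpen Ω) {k : Fin n}
    (hu : IsRegular Ω (u k)) {φ : E m d → ℝ} (hφ : IsTest Ω φ) :
    IntegrableOn (energyTerm (a k) (u k) φ) Ω := by
  obtain ⟨M, hM0, hM⟩ := hu.exists_normGradY_le
  refine Integrable.mul_bdd (c := M ^ 2) (hstab.form_integrable k φ hφ)
    (hu.aestronglyMeasurable_comp_normGradY hΩ (continuous_pow 2) hΩ.measurableSet subset_rfl)
    ((ae_restrict_iff' hΩ.measurableSet).2 (ae_of_all _ fun X hX => ?_))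
  rw [norm_pow, norm_norm]
  exact pow_le_pow_left₀ (norm_nonneg _) (hM X hX) 2

theorem integral_energyTerm {a : EuclideanSpace ℝ (Fin m) → ℝ → ℝ} {u : E m d → ℝ}
    (hΩ : IsOpen Ω) (φ : E m d → ℝ) :
    ∫ X in Ω, energyTerm a u φ X = ∫ X in regularSet Ω u,
      formA a u X (gradient φ X) (gradient φ X) * normGradY u X ^ 2 := by
  refine setIntegral_eq_of_subset_of_forall_sdiff_eq_zero hΩ.measurableSet
    (regularSet_subset Ω u) fun X hX => ?_
  have : gradY u X = 0 := by
    by_contra h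
    exact hX.2 ⟨hX.1, h⟩
  simp [energyTerm, this]

theorem abs_inner_gradY_le (f g : E m d → ℝ) (X : E m d) :
    |inner ℝ (gradY f X) (gradY g X)| ≤ normGradY f X * normGradY g X :=
  abs_real_inner_le_norm _ _

/-- The stability inequality for the functions `ψ^k |∇_y u^k|`. -/
theorem IsStable.nonneg_normGradY (hstab : IsStable Ω a F u) (hΩ : IsOpen Ω)
    (hreg : ∀ i, IsRegular Ω (u i)) (hA : ∀ i, BoundedMatrix Ω (a i) (u i))
    (hψ : ∀ i, IsTest Ω (ψ i)) :
    0 ≤ (∑ k, ((∫ X in regularSet Ω (u k), formA (a k) (u k) X (gradient (ψ k) X)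
            (gradient (ψ k) X) * normGradY (u k) X ^ 2)
          + 2 * (∫ X in regularSet Ω (u k), formA (a k) (u k) X (gradient (ψ k) X)
            (gradient (normGradY (u k)) X) * ψ k X * normGradY (u k) X)
          + ∫ X in regularSet Ω (u k), formA (a k) (u k) X (gradient (normGradY (u k)) X)
            (gradient (normGradY (u k)) X) * ψ k X ^ 2))
      - ∑ i, ∑ j, ∫ X in Ω, F2 F u i j X * (ψ i X * ψ j X)
          * (normGradY (u i) X * normGradY (u j) X) := by
  have hcut := fun l k => (hreg k).cutoff_mul hΩ (hψ k) ((hreg k).contDiffOn_normGradY hΩ) l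
  have h1 := tendsto_finsetSum (Finset.univ : Finset (Fin n)) fun k _ =>
    (hreg k).tendsto_integral_formA_cutoff hΩ (hA k) (hψ k) (hstab.form_integrable k (ψ k) (hψ k))
  choose M hM0 hM using fun k => (hreg k).exists_normGradY_le
  have h2 : Tendsto (fun l => ∑ i, ∑ j, ∫ X, F2 F u i j X
        * (cutoff l (normGradY (u i) X) * (ψ i X * normGradY (u i) X))
        * (cutoff l (normGradY (u j) X) * (ψ j X * normGradY (u j) X))) atTop
      (𝓝 (∑ i, ∑ j, ∫ X in Ω, F2 F u i j X * (ψ i X * ψ j X)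
          * (normGradY (u i) X * normGradY (u j) X))) := by
    refine tendsto_finsetSum _ fun i _ => tendsto_finsetSum _ fun j _ => ?_
    have hm : ∀ (l : ℕ) (k : Fin n), AEStronglyMeasurable
        (fun X => normGradY (u k) X * cutoff l (normGradY (u k) X)) (volume.restrict Ω) :=
      fun l k => (hreg k).aestronglyMeasurable_comp_normGradY hΩ
        (continuous_id.mul (contDiff_cutoff l).continuous) hΩ.measurableSet subset_rfl
    have hb : ∀ (l : ℕ) (k : Fin n), ∀ X ∈ Ω,
        |normGradY (u k) X * cutoff l (normGradY (u k) X)| ≤ M k := fun l k X hX => by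
      rw [abs_mul, abs_of_nonneg (normGradY_nonneg _ X)]
      exact (mul_le_of_le_one_right (normGradY_nonneg _ X) (abs_cutoff_le_one l _)).trans
        (hM k X hX)
    have t := tendsto_integral_mul_of_bounded
      (hstab.integrableOn_potential_mul (hψ i) (hψ j).1.continuous.continuousOn i j)
      (g := fun l X => (normGradY (u i) X * cutoff l (normGradY (u i) X))
        * (normGradY (u j) X * cutoff l (normGradY (u j) X))) (C := M i * M j)
      (fun l => (hm l i).mul (hm l j))
      (fun l => (ae_restrict_iff' hΩ.measurableSet).2 (ae_of_all _ fun X hX => by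
        rw [abs_mul]
        exact mul_le_mul (hb l i X hX) (hb l j X hX) (abs_nonneg _) (hM0 i)))
      (ae_of_all _ fun X => (tendsto_mul_cutoff (normGradY_nonneg (u i) X)).mul
        (tendsto_mul_cutoff (normGradY_nonneg (u j) X)))
    refine t.congr fun l => ?_
    rw [integral_eq_of_tsupport_subset (hψ i).2.2 (fun X hX => by simp [hX])]
    exact integral_congr_ae (ae_of_all _ fun X => by ring)
  refine ge_of_tendsto' (h1.sub h2) fun l => ?_
  exact hstab.nonneg_of_contDiff hΩ hreg hA (fun k => (hcut l k).1) (fun k => (hcut l k).2.1)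
    (fun k => (hcut l k).2.2.trans (regularSet_subset_noncriticalSet Ω (u k)))

/-- The linearized equation for `u^k_{y_j}`, tested with `(ψ^k)² u^k_{y_j}` and summed over `j`. -/
theorem IsWeakSolution.linearized_gradY (hsol : IsWeakSolution Ω a F u) (hΩ : IsOpen Ω)
    (ha : ∀ i, IsCoefficient (a i)) (hF : ∀ x, ContDiff ℝ 2 (F x))
    (hreg : ∀ i, IsRegular Ω (u i)) (hA : ∀ i, BoundedMatrix Ω (a i) (u i))
    (hstab : IsStable Ω a F u) (k : Fin n) {φ : E m d → ℝ} (hφ : IsTest Ω φ) :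
    (∫ X in regularSet Ω (u k), (∑ j : Fin d, formA (a k) (u k) X
          (gradient (pd (u k) (Sum.inr j)) X) (gradient (pd (u k) (Sum.inr j)) X)) * φ X ^ 2)
        + 2 * (∫ X in regularSet Ω (u k), formA (a k) (u k) X (gradient φ X)
            (gradient (normGradY (u k)) X) * φ X * normGradY (u k) X)
      = ∑ i, ∫ X in Ω, F2 F u k i X * (φ X * φ X) * inner ℝ (gradY (u i) X) (gradY (u k) X) := by
  have h1 := (hreg k).tendsto_sum_integral_formA_cutoff hΩ (hA k) hφ
  have hg : ∀ j : Fin d, ContDiffOn ℝ 1 (fun Y => φ Y * pd (u k) (Sum.inr j) Y)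
      (regularSet Ω (u k)) := fun j => (hφ.1.of_le (by exact_mod_cast le_top)).contDiffOn.mul
      (((hreg k).contDiffOn_pd_noncriticalSet hΩ _).mono (regularSet_subset_noncriticalSet _ _))
  have hcut := fun l j => (hreg k).cutoff_mul hΩ hφ (hg j) l
  have hu1 := fun i => (hreg i).contDiffOn_one
  have hgc := fun i => continuousOn_gradY hΩ (hu1 i)
  choose M hM0 hM using fun i => (hreg i).exists_normGradY_le
  have hmχ : ∀ l : ℕ, ContinuousOn (fun X => cutoff l (normGradY (u k) X)) Ω := fun l =>
    (contDiff_cutoff l).continuous.comp_continuousOn ((hreg k).continuousOn_normGradY hΩ)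
  have hinner : ∀ i, ContinuousOn (fun X => inner ℝ (gradY (u i) X) (gradY (u k) X)) Ω :=
    fun i => (hgc i).inner (𝕜 := ℝ) (hgc k)
  have h2 := tendsto_finsetSum (Finset.univ : Finset (Fin n)) fun i _ =>
    tendsto_integral_mul_of_bounded
      (hstab.integrableOn_potential_mul hφ hφ.1.continuous.continuousOn k i)
      (g := fun l X => inner ℝ (gradY (u i) X) (gradY (u k) X) * cutoff l (normGradY (u k) X))
      (h := fun X => inner ℝ (gradY (u i) X) (gradY (u k) X)) (C := M i * M k * 1)
      (fun l => ((hinner i).mul (hmχ l)).aestronglyMeasurable hΩ.measurableSet)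
      (fun l => (ae_restrict_iff' hΩ.measurableSet).2 (ae_of_all _ fun X hX => by
        rw [abs_mul]
        exact mul_le_mul ((abs_inner_gradY_le _ _ X).trans (mul_le_mul (hM i X hX) (hM k X hX)
          (normGradY_nonneg _ _) (hM0 i))) (abs_cutoff_le_one l _) (abs_nonneg _)
          (mul_nonneg (hM0 i) (hM0 k))))
      -- Where ∇_y u^k = 0 the cutoff does not tend to 1, but there the inner product is 0 and the
      -- limit holds trivially.
      (ae_of_all _ fun X => by
        rcases (normGradY_nonneg (u k) X).eq_or_lt with h | h
        · have h0 : gradY (u k) X = 0 := norm_eq_zero.1 h.symm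
          simp [h0]
        · simpa using (tendsto_cutoff h).const_mul (inner ℝ (gradY (u i) X) (gradY (u k) X)))
  refine tendsto_nhds_unique h1 (h2.congr fun l => ?_)
  have h3 : ∀ j : Fin d, ∫ X, formA (a k) (u k) X (gradient (pd (u k) (Sum.inr j)) X)
      (gradient (fun Y => cutoff l (normGradY (u k) Y) * (φ Y * (φ Y * pd (u k) (Sum.inr j) Y))) X)
      = ∑ i, ∫ X in Ω, F2 F u k i X * (φ X * (φ X * pd (u i) (Sum.inr j) X
          * pd (u k) (Sum.inr j) X * cutoff l (normGradY (u k) X))) := by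
    intro j
    rw [hsol.linearized hΩ ha hF hreg hA hstab k j (hcut l j).1 (hcut l j).2.1
      ((hcut l j).2.2.trans (regularSet_subset_noncriticalSet _ _)),
      ← integral_eq_of_tsupport_subset hφ.2.2 (fun X hX => by simp [hX]), ← integral_finsetSum]
    · refine integral_congr_ae (ae_of_all _ fun X => ?_)
      simp only [Finset.sum_mul]
      exact Finset.sum_congr rfl fun i _ => by ring
    · exact fun i _ => hstab.integrableOn_potential_mul hφ
        (((hφ.1.continuous.continuousOn.mul (continuousOn_pd hΩ (hu1 i) _)).mul
          (continuousOn_pd hΩ (hu1 k) _)).mul (hmχ l)) k i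
  simp_rw [h3]
  rw [Finset.sum_comm]
  refine Finset.sum_congr rfl fun i _ => ?_
  rw [← integral_finsetSum]
  · refine integral_congr_ae (ae_of_all _ fun X => ?_)
    simp only [PiLp.inner_apply, gradY_apply, RCLike.inner_apply, conj_trivial, Finset.mul_sum,
      Finset.sum_mul]
    exact Finset.sum_congr rfl fun j _ => by ring
  · exact fun j _ => hstab.integrableOn_potential_mul hφ
      (((hφ.1.continuous.continuousOn.mul (continuousOn_pd hΩ (hu1 i) _)).mul
        (continuousOn_pd hΩ (hu1 k) _)).mul (hmχ l)) k i

theorem IsStable.integrableOn_coupling_parts (hstab : IsStable Ω a F u) (hΩ : IsOpen Ω)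
    (hreg : ∀ i, IsRegular Ω (u i)) (hψ : ∀ i, IsTest Ω (ψ i)) (k j : Fin n) :
    IntegrableOn (fun X => F2 F u k j X * (ψ k X * ψ k X)
        * inner ℝ (gradY (u j) X) (gradY (u k) X)) Ω ∧
      IntegrableOn (fun X => F2 F u k j X * (ψ k X * ψ j X)
        * (normGradY (u k) X * normGradY (u j) X)) Ω := by
  have hgc := fun i => continuousOn_gradY hΩ (hreg i).contDiffOn_one
  have hψc := fun i => (hψ i).1.continuous.continuousOn (s := Ω)
  constructor
  · simpa only [mul_assoc, Pi.mul_apply] using hstab.integrableOn_potential_mul (hψ k)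
      ((hψc k).mul ((hgc j).inner (𝕜 := ℝ) (hgc k))) k j
  · simpa only [mul_assoc, Pi.mul_apply] using hstab.integrableOn_potential_mul (hψ k)
      ((hψc j).mul (((hreg k).continuousOn_normGradY hΩ).mul
        ((hreg j).continuousOn_normGradY hΩ))) k j

theorem couplingTerm_eq (k j : Fin n) (X : E m d) :
    couplingTerm F u ψ k j X
      = F2 F u k j X * (ψ k X * ψ k X) * inner ℝ (gradY (u j) X) (gradY (u k) X)
        - F2 F u k j X * (ψ k X * ψ j X) * (normGradY (u k) X * normGradY (u j) X) := by
  rw [couplingTerm, normGradY, normGradY]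
  ring

/-- This allows the sum over j ≠ k to be replaced by the sum over all j, the form in which both the
stability inequality and the linearized equation deliver it. -/
theorem couplingTerm_self (k : Fin n) (X : E m d) : couplingTerm F u ψ k k X = 0 := by
  rw [couplingTerm, real_inner_self_eq_norm_sq]
  ring

/-- Let P, Q, R be the energy, mixed and |∇_y u|-gradient integrals, L that of ∑_j ⟨𝒜∇u_{y_j},
∇u_{y_j}⟩ψ², all summed over k, and V₁, V₂ the two potential sums. Stability says P + 2Q + R - V₂ ≥
0 and the equation says L + 2Q = V₁; eliminating Q gives L - R ≤ P + V₁ - V₂. -/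
theorem sum_integral_formTerm_le (hΩ : IsOpen Ω) (ha : ∀ i, IsCoefficient (a i))
    (hF : ∀ x, ContDiff ℝ 2 (F x)) (hreg : ∀ i, IsRegular Ω (u i))
    (hA : ∀ i, BoundedMatrix Ω (a i) (u i)) (hsol : IsWeakSolution Ω a F u)
    (hstab : IsStable Ω a F u) (hψ : ∀ k, IsTest Ω (ψ k)) :
    (∑ k, ∫ X in regularSet Ω (u k), formTerm (a k) (u k) X * ψ k X ^ 2)
      ≤ (∫ X in Ω, ∑ k, energyTerm (a k) (u k) (ψ k) X)
        + ∑ k, ∑ j ∈ Finset.univ.erase k, ∫ X in Ω, couplingTerm F u ψ k j X := by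
  have hcoup : ∀ k, ∑ j ∈ Finset.univ.erase k, ∫ X in Ω, couplingTerm F u ψ k j X
      = ∑ j, ((∫ X in Ω, F2 F u k j X * (ψ k X * ψ k X)
            * inner ℝ (gradY (u j) X) (gradY (u k) X))
          - ∫ X in Ω, F2 F u k j X * (ψ k X * ψ j X)
            * (normGradY (u k) X * normGradY (u j) X)) := by
    intro k
    rw [Finset.sum_erase _ (by simp [couplingTerm_self])]
    refine Finset.sum_congr rfl fun j _ => ?_
    obtain ⟨h1, h2⟩ := hstab.integrableOn_coupling_parts hΩ hreg hψ k j
    simp_rw [couplingTerm_eq]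
    exact integral_sub h1 h2
  have hform : ∀ k, ∫ X in regularSet Ω (u k), formTerm (a k) (u k) X * ψ k X ^ 2
      = (∫ X in regularSet Ω (u k), (∑ j : Fin d, formA (a k) (u k) X
          (gradient (pd (u k) (Sum.inr j)) X) (gradient (pd (u k) (Sum.inr j)) X)) * ψ k X ^ 2)
        - ∫ X in regularSet Ω (u k), formA (a k) (u k) X (gradient (normGradY (u k)) X)
            (gradient (normGradY (u k)) X) * ψ k X ^ 2 := by
    intro k
    simp_rw [formTerm, sub_mul]
    exact integral_sub ((hreg k).integrableOn_formTerm hΩ (hA k) (hψ k)).1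
      ((hreg k).integrableOn_formA_normGradY hΩ (hA k) (hψ k))
  have hlin := Finset.sum_congr rfl fun k (_ : k ∈ (Finset.univ : Finset (Fin n))) =>
    hsol.linearized_gradY hΩ ha hF hreg hA hstab k (hψ k)
  have hst := hstab.nonneg_normGradY hΩ hreg hA hψ
  rw [integral_finsetSum _ fun k _ => hstab.integrableOn_energyTerm hΩ (hreg k) (hψ k)]
  simp only [integral_energyTerm hΩ, hcoup, hform, Finset.sum_add_distrib,
    Finset.sum_sub_distrib] at hlin hst ⊢
  linarith

end System

end Fibered

end

theorem mainTheorem1 (m d n : ℕ) (hm : 1 ≤ m) (hd : 1 ≤ d)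
    (Ω : Set (Fibered.E m d)) (hΩ : IsOpen Ω)
    (a : Fin n → EuclideanSpace ℝ (Fin m) → ℝ → ℝ)
    (ha : ∀ i, Fibered.IsCoefficient (a i))
    (F : EuclideanSpace ℝ (Fin m) → EuclideanSpace ℝ (Fin n) → ℝ)
    (hF : ∀ x, ContDiff ℝ 2 (F x))
    (u : Fin n → Fibered.E m d → ℝ)
    (hreg : ∀ i, Fibered.IsRegular Ω (u i))
    (hA : ∀ i, Fibered.BoundedMatrix Ω (a i) (u i))
    (hsol : Fibered.IsWeakSolution Ω a F u)
    (hstab : Fibered.IsStable Ω a F u)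
    (ψ : Fin n → Fibered.E m d → ℝ) (hψ : ∀ k, Fibered.IsTest Ω (ψ k)) :
    -- all the integrals below converge
    ((∀ k, IntegrableOn (fun X => Fibered.formTerm (a k) (u k) X * ψ k X ^ 2)
        (Fibered.regularSet Ω (u k))) ∧
      (∀ k, IntegrableOn (fun X => Fibered.geometricTerm (a k) (u k) X * ψ k X ^ 2)
        (Fibered.regularSet Ω (u k))) ∧
      (∀ k j, IntegrableOn (Fibered.couplingTerm F u ψ k j) Ω) ∧
      (∀ k, IntegrableOn (Fibered.energyTerm (a k) (u k) (ψ k)) Ω)) ∧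
    -- first form
    (∑ k, ∫ X in Fibered.regularSet Ω (u k), Fibered.formTerm (a k) (u k) X * ψ k X ^ 2)
        - (∑ k, ∑ j ∈ Finset.univ.erase k, ∫ X in Ω, Fibered.couplingTerm F u ψ k j X)
      ≤ ∫ X in Ω, ∑ k, Fibered.energyTerm (a k) (u k) (ψ k) X ∧
    -- second form
    (∑ k, ∫ X in Fibered.regularSet Ω (u k), Fibered.geometricTerm (a k) (u k) X * ψ k X ^ 2)
      ≤ (∫ X in Ω, ∑ k, Fibered.energyTerm (a k) (u k) (ψ k) X)
        + ∑ k, ∑ j ∈ Finset.univ.erase k, ∫ X in Ω, Fibered.couplingTerm F u ψ k j X := by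
  have hRm := fun k => ((hreg k).isOpen_regularSet hΩ).measurableSet
  have hgeo : ∀ k, EqOn (fun X => Fibered.geometricTerm (a k) (u k) X * ψ k X ^ 2)
      (fun X => Fibered.formTerm (a k) (u k) X * ψ k X ^ 2) (Fibered.regularSet Ω (u k)) :=
    fun k X hX => by simp only [(hreg k).geometricTerm_eq_formTerm hΩ hX]
  have hform := fun k => ((hreg k).integrableOn_formTerm hΩ (hA k) (hψ k)).2
  have hmain := Fibered.sum_integral_formTerm_le hΩ ha hF hreg hA hsol hstab hψ
  refine ⟨⟨hform, fun k => (integrableOn_congr_fun (hgeo k) (hRm k)).2 (hform k), fun k j => ?_,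
    fun k => hstab.integrableOn_energyTerm hΩ (hreg k) (hψ k)⟩, sub_le_iff_le_add.2 hmain, ?_⟩
  · obtain ⟨h1, h2⟩ := hstab.integrableOn_coupling_parts hΩ hreg hψ k j
    exact (h1.sub h2).congr (Filter.Eventually.of_forall fun X =>
      (Fibered.couplingTerm_eq k j X).symm)
  · rwa [Finset.sum_congr rfl fun k _ => setIntegral_congr_fun (hRm k) (hgeo k)]
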